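/- Let $\mu>-\tfrac12$, and put $c_\mu=2^{\mu}\Gamma(\mu+1)$, $r(x)=x^{-\mu-\frac12}$ and $s(x)=x^{2\mu+1}/c_\mu$ for $x>0$. Let $Y=L^1(sr)\cap L^\infty(r)$ be the space of (classes modulo equality a.e. of) measurable functions $f:(0,\infty)\to\mathbb C$ for which $$\|f\|_Y=\max\Bigl(\int_0^\infty |f|\,s\,r\,dx,\ \operatorname{ess\,sup}_{x>0}|r(x)f(x)|\Bigr)$$ is finite. Let $\mathcal H_\mu$ be the space of all $\phi\in C^\infty(0,\infty)$ such that $\sup_{x>0}\bigl|x^m(x^{-1}\tfrac{d}{dx})^k\bigl(x^{-\mu-\frac12}\phi(x)\bigr)\bigr|<\infty$ for all integers $m,k\ge 0$, and let $S_\mu=\frac{d^2}{dx^2}-\frac{4\mu^2-1}{4x^2}$. For $f,g\in Y$ we write $S_\mu f=g$ if this holds in the dual $\mathcal H_\mu'$, that is, if $\int_0^\infty g\,\phi\,dx=\int_0^\infty f\,S_\mu\phi\,dx$ for all $\phi\in\mathcal H_\mu$; such a $g$ is unique if it exists, and we then say that $S_\mu f\in Y$. Let $$\mathcal B=\{f\in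 Y:\ S_\mu^k f\in Y\ \text{ for } k=0,1,2,\dots\}$$ with the topology defined by the seminorms $\rho_m(f)=\max_{0\le k\le m}\|S_\mu^k f\|_Y$, $m=0,1,2,\dots$, and let $(S_\mu)_{\mathcal B}:\mathcal B\to\mathcal B$, $f\mapsto S_\mu f$, be the part of $S_\mu$ in $\mathcal B$. Then $\mathcal B$ is a Fréchet space (a complete metrizable locally convex space), and $-(S_\mu)_{\mathcal B}$ is a continuous and non-negative operator on $\mathcal B$. Here a linear operator $A$ on a locally convex space is called non-negative if $(-\infty,0)$ is contained in its resolvent set and the family of operators $\{\lambda(\lambda+A)^{-1}:\lambda>0\}$ is equicontinuous. -/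

import Mathlib

open MeasureTheory Set Filter Topology
open scoped ENNReal ContDiff

namespace Bessel

noncomputable section

/-! ### Weights and weighted Lebesgue spaces on `(0, ∞)` -/

/-- Lebesgue measure on `(0, ∞)`. -/
abbrev halfLine : Measure ℝ := volume.restrict (Ioi 0)

/-- `c_μ = 2^μ Γ(μ + 1)`. -/
def cConst (μ : ℝ) : ℝ := 2 ^ μ * Real.Gamma (μ + 1)

/-- `r(x) = x^(-μ - 1/2)`. -/
def rWeight (μ x : ℝ) : ℝ := x ^ (-μ - 1 / 2)

/-- `s(x) = x^(2μ + 1) / c_μ`. -/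
def sWeight (μ x : ℝ) : ℝ := x ^ (2 * μ + 1) / cConst μ

theorem weighted_add (w : ℝ → ℝ) (f g : ℝ →ₘ[halfLine] ℂ) :
    (fun x => (w x : ℂ) * (f + g) x) =ᵐ[halfLine]
      (fun x => (w x : ℂ) * f x) + fun x => (w x : ℂ) * g x := by
  filter_upwards [AEEqFun.coeFn_add f g] with x hx
  simp [hx, mul_add]

theorem weighted_smul (w : ℝ → ℝ) (c : ℂ) (f : ℝ →ₘ[halfLine] ℂ) :
    (fun x => (w x : ℂ) * (c • f) x) =ᵐ[halfLine] c • fun x => (w x : ℂ) * f x := by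
  filter_upwards [AEEqFun.coeFn_smul c f] with x hx
  simp [hx, mul_left_comm]

/-- The classes `f` (modulo equality a.e. on `(0, ∞)`) of complex functions with
`w f ∈ L^p(0, ∞)`. For `p = 1` and `w > 0` this is `∫ |f| w dx < ∞`, for `p = ∞` it is
`ess sup |w f| < ∞`. -/
def weightedLp (w : ℝ → ℝ) (p : ℝ≥0∞) : Submodule ℂ (ℝ →ₘ[halfLine] ℂ) where
  carrier := {f | MemLp (fun x => (w x : ℂ) * f x) p halfLine}
  add_mem' {f g} hf hg := (memLp_congr_ae (weighted_add w f g)).2 (MemLp.add hf hg)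
  zero_mem' := by
    have h : (fun x => (w x : ℂ) * (0 : ℝ →ₘ[halfLine] ℂ) x) =ᵐ[halfLine]
        (0 : ℝ → ℂ) := by
      filter_upwards [AEEqFun.coeFn_zero (α := ℝ) (μ := halfLine) (β := ℂ)] with x hx
      simp [hx]
    exact (memLp_congr_ae h).2 MemLp.zero
  smul_mem' c f hf := (memLp_congr_ae (weighted_smul w c f)).2 (MemLp.const_smul hf c)

/-- The norm `‖w f‖_{L^p(0, ∞)}`: for `p = 1` and `w > 0` it is `∫ |f| w dx`, for `p = ∞` it is
`ess sup |w f|`. -/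
def weightedNorm (w : ℝ → ℝ) (p : ℝ≥0∞) (hp : 1 ≤ p) : Seminorm ℂ (weightedLp w p) :=
  Seminorm.of (fun f => (eLpNorm (fun x => (w x : ℂ) * f.1 x) p halfLine).toReal)
    (fun f g => by
      have hf : MemLp (fun x => (w x : ℂ) * f.1 x) p halfLine := f.2
      have hg : MemLp (fun x => (w x : ℂ) * g.1 x) p halfLine := g.2
      rw [← ENNReal.toReal_add hf.2.ne hg.2.ne, Submodule.coe_add,
        eLpNorm_congr_ae (weighted_add w f.1 g.1)]
      exact ENNReal.toReal_mono (ENNReal.add_ne_top.2 ⟨hf.2.ne, hg.2.ne⟩)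
        (eLpNorm_add_le hf.1 hg.1 hp))
    (fun c f => by
      rw [Submodule.coe_smul, eLpNorm_congr_ae (weighted_smul w c f.1), eLpNorm_const_smul,
        ENNReal.toReal_mul]
      simp)

/-- `Y = L^1(s r) ∩ L^∞(r)`. -/
def Y (μ : ℝ) : Submodule ℂ (ℝ →ₘ[halfLine] ℂ) :=
  weightedLp (fun x => sWeight μ x * rWeight μ x) 1 ⊓ weightedLp (rWeight μ) ∞

/-- `‖f‖_Y = max (‖f‖_{L^1(s r)}, ‖f‖_{L^∞(r)})`. -/
def normY (μ : ℝ) : Seminorm ℂ (Y μ) :=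
  (weightedNorm (fun x => sWeight μ x * rWeight μ x) 1 le_rfl).comp
      (Submodule.inclusion inf_le_left) ⊔
    (weightedNorm (rWeight μ) ∞ le_top).comp (Submodule.inclusion inf_le_right)

/-! ### The Zemanian space `H_μ` and the distributional Bessel operator -/

/-- The operator `x⁻¹ D`. -/
def xInvD (φ : ℝ → ℂ) : ℝ → ℂ := fun x => (x : ℂ)⁻¹ * deriv φ x

/-- `φ ∈ H_μ`: `φ` is smooth on `(0, ∞)` and all the quantities
`sup_{x > 0} |x^m (x⁻¹ D)^k (x^(-μ-1/2) φ(x))|` are finite. Only the restriction of `φ` to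
`(0, ∞)` matters. -/
def MemH (μ : ℝ) (φ : ℝ → ℂ) : Prop :=
  ContDiffOn ℝ ∞ φ (Ioi 0) ∧
    ∀ m k : ℕ, ∃ C : ℝ, ∀ x : ℝ, 0 < x →
      ‖(x : ℂ) ^ m * (xInvD^[k] fun y => (rWeight μ y : ℂ) * φ y) x‖ ≤ C

/-- The Bessel differential operator `S_μ = d²/dx² - (4μ² - 1)/(4x²)` on smooth functions. -/
def besselDiff (μ : ℝ) (φ : ℝ → ℂ) : ℝ → ℂ :=
  fun x => deriv (deriv φ) x - (((4 * μ ^ 2 - 1) / (4 * x ^ 2) : ℝ) : ℂ) * φ x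

/-- `S_μ f = g` in the dual `H_μ'`, for functions `f`, `g` seen as regular elements
`φ ↦ ∫ f φ`, `φ ↦ ∫ g φ` of `H_μ'`, where `(S_μ u, φ) = (u, S_μ φ)` for `φ ∈ H_μ`.
The two integrability clauses say that the pairings are defined. -/
def IsBesselImage (μ : ℝ) (f g : ℝ →ₘ[halfLine] ℂ) : Prop :=
  ∀ φ : ℝ → ℂ, MemH μ φ →
    Integrable (fun x => g x * φ x) halfLine ∧
    Integrable (fun x => f x * besselDiff μ φ x) halfLine ∧
    ∫ x, g x * φ x ∂halfLine = ∫ x, f x * besselDiff μ φ x ∂halfLine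

theorem pair_add (f g : ℝ →ₘ[halfLine] ℂ) (φ : ℝ → ℂ) :
    (fun x => (f + g) x * φ x) =ᵐ[halfLine] (fun x => f x * φ x) + fun x => g x * φ x := by
  filter_upwards [AEEqFun.coeFn_add f g] with x hx
  simp [hx, add_mul]

theorem pair_smul (c : ℂ) (f : ℝ →ₘ[halfLine] ℂ) (φ : ℝ → ℂ) :
    (fun x => (c • f) x * φ x) =ᵐ[halfLine] c • fun x => f x * φ x := by
  filter_upwards [AEEqFun.coeFn_smul c f] with x hx
  simp [hx, mul_assoc]

theorem pair_zero (φ : ℝ → ℂ) :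
    (fun x => (0 : ℝ →ₘ[halfLine] ℂ) x * φ x) =ᵐ[halfLine] 0 := by
  filter_upwards [AEEqFun.coeFn_zero (α := ℝ) (μ := halfLine) (β := ℂ)] with x hx
  simp [hx]

theorem IsBesselImage.add {μ : ℝ} {f₁ g₁ f₂ g₂ : ℝ →ₘ[halfLine] ℂ}
    (h₁ : IsBesselImage μ f₁ g₁) (h₂ : IsBesselImage μ f₂ g₂) :
    IsBesselImage μ (f₁ + f₂) (g₁ + g₂) := by
  intro φ hφ
  obtain ⟨a₁, b₁, e₁⟩ := h₁ φ hφ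
  obtain ⟨a₂, b₂, e₂⟩ := h₂ φ hφ
  refine ⟨(integrable_congr (pair_add _ _ _)).2 (a₁.add a₂),
    (integrable_congr (pair_add _ _ _)).2 (b₁.add b₂), ?_⟩
  rw [integral_congr_ae (pair_add g₁ g₂ φ), integral_congr_ae (pair_add f₁ f₂ _),
    integral_add' a₁ a₂, integral_add' b₁ b₂, e₁, e₂]

theorem IsBesselImage.smul {μ : ℝ} {f g : ℝ →ₘ[halfLine] ℂ} (c : ℂ)
    (h : IsBesselImage μ f g) : IsBesselImage μ (c • f) (c • g) := by
  intro φ hφ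
  obtain ⟨a, b, e⟩ := h φ hφ
  refine ⟨(integrable_congr (pair_smul _ _ _)).2 (a.smul c),
    (integrable_congr (pair_smul _ _ _)).2 (b.smul c), ?_⟩
  rw [integral_congr_ae (pair_smul c g φ), integral_congr_ae (pair_smul c f _)]
  simp only [Pi.smul_apply]
  rw [integral_smul, integral_smul, e]

theorem IsBesselImage.zero (μ : ℝ) : IsBesselImage μ 0 0 := by
  intro φ _
  refine ⟨(integrable_congr (pair_zero _)).2 (integrable_zero _ _ _),
    (integrable_congr (pair_zero _)).2 (integrable_zero _ _ _), ?_⟩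
  rw [integral_congr_ae (pair_zero φ), integral_congr_ae (pair_zero _)]

/-! Smooth functions with compact support in `(0, ∞)` belong to `H_μ`; hence `S_μ f`, if it is a
function, is unique a.e. -/

/-- Smooth functions on the line whose support is compact and contained in `(0, ∞)`. -/
def IsTest (ψ : ℝ → ℂ) : Prop :=
  ContDiff ℝ ∞ ψ ∧ HasCompactSupport ψ ∧ tsupport ψ ⊆ Ioi 0

theorem IsTest.mul {ψ a : ℝ → ℂ} (hψ : IsTest ψ) (ha : ContDiffOn ℝ ∞ a (Ioi 0)) :
    IsTest fun x => a x * ψ x := by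
  have hsub : tsupport (fun x => a x * ψ x) ⊆ tsupport ψ := tsupport_mul_subset_right
  refine ⟨contDiff_iff_contDiffAt.2 fun x => ?_, hψ.2.1.mul_left, hsub.trans hψ.2.2⟩
  by_cases hx : 0 < x
  · exact (ha.contDiffAt (Ioi_mem_nhds hx)).mul hψ.1.contDiffAt
  · have hx' : x ∉ tsupport (fun x => a x * ψ x) := fun h => hx (hψ.2.2 (hsub h))
    exact (contDiffAt_const (c := (0 : ℂ))).congr_of_eventuallyEq
      (notMem_tsupport_iff_eventuallyEq.1 hx')

theorem contDiffOn_inv : ContDiffOn ℝ ∞ (fun x : ℝ => (x : ℂ)⁻¹) (Ioi 0) := by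
  refine ContDiffOn.inv Complex.ofRealCLM.contDiff.contDiffOn fun x hx => ?_
  have : (0 : ℝ) < x := hx
  simpa using this.ne'

theorem contDiffOn_rWeight (μ : ℝ) :
    ContDiffOn ℝ ∞ (fun x : ℝ => (rWeight μ x : ℂ)) (Ioi 0) := by
  have h : ContDiffOn ℝ ∞ (rWeight μ) (Ioi 0) := fun x hx =>
    (Real.contDiffAt_rpow_const_of_ne (ne_of_gt hx)).contDiffWithinAt
  exact Complex.ofRealCLM.contDiff.comp_contDiffOn h

theorem IsTest.xInvD {ψ : ℝ → ℂ} (hψ : IsTest ψ) : IsTest (xInvD ψ) := by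
  have hd : IsTest (deriv ψ) := by
    refine ⟨?_, hψ.2.1.deriv, ?_⟩
    · exact (contDiff_infty_iff_deriv.1 hψ.1).2
    · exact (closure_minimal (support_deriv_subset) (isClosed_tsupport ψ)).trans hψ.2.2
  exact hd.mul contDiffOn_inv

theorem IsTest.memH {ψ : ℝ → ℂ} (μ : ℝ) (hψ : IsTest ψ) : MemH μ ψ := by
  refine ⟨hψ.1.contDiffOn, fun m k => ?_⟩
  have h : IsTest (Bessel.xInvD^[k] fun y => (rWeight μ y : ℂ) * ψ y) := by
    induction k with
    | zero => exact hψ.mul (contDiffOn_rWeight μ)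
    | succ k ih => rw [Function.iterate_succ_apply']; exact ih.xInvD
  have h2 := h.mul (a := fun x : ℝ => (x : ℂ) ^ m)
    (Complex.ofRealCLM.contDiff.pow m).contDiffOn
  obtain ⟨C, hC⟩ := h2.1.continuous.bounded_above_of_compact_support h2.2.1
  exact ⟨C, fun x _ => hC x⟩

theorem IsBesselImage.unique {μ : ℝ} {f g₁ g₂ : ℝ →ₘ[halfLine] ℂ}
    (h₁ : IsBesselImage μ f g₁) (h₂ : IsBesselImage μ f g₂) : g₁ = g₂ := by
  have h := h₁.add (h₂.smul (-1))
  set g := g₁ + (-1 : ℂ) • g₂ with hg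
  have hf0 : f + (-1 : ℂ) • f = 0 := by rw [neg_one_smul ℂ f, add_neg_cancel]
  rw [hf0] at h
  have hz : ∀ φ, MemH μ φ → ∫ x, g x * φ x ∂halfLine = 0 := fun φ hφ => by
    rw [(h φ hφ).2.2, integral_congr_ae (pair_zero _)]; simp
  have hloc : LocallyIntegrableOn (⇑g) (Ioi 0) halfLine := by
    intro x hx
    obtain ⟨b, hb1, hb2, hb3, -, hb4⟩ :=
      exists_contDiff_tsupport_subset (n := ⊤) (Ioi_mem_nhds hx : Ioi (0 : ℝ) ∈ 𝓝 x)
    have hc : Continuous b := hb3.continuous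
    have ht : IsTest fun y => (b y : ℂ) := by
      refine ⟨Complex.ofRealCLM.contDiff.comp hb3, hb2.comp_left (g := Complex.ofReal) rfl, ?_⟩
      exact (closure_mono (Function.support_comp_subset (g := Complex.ofReal) rfl b)).trans hb1
    have hi := (h _ (ht.memH μ)).1
    have hpos : {y | 1 / 2 < b y} ∈ 𝓝 x :=
      (isOpen_lt continuous_const hc).mem_nhds (by simp [hb4]; norm_num)
    refine ⟨{y | 1 / 2 < b y}, mem_nhdsWithin_of_mem_nhds hpos, ?_⟩
    refine Integrable.mono (g := fun y => (2 : ℂ) * (g y * (b y : ℂ)))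
      (hi.const_mul 2).restrict g.aestronglyMeasurable.restrict ?_
    refine (ae_restrict_iff' (isOpen_lt continuous_const hc).measurableSet).2 (.of_forall ?_)
    intro y hy
    have hy : 1 / 2 < b y := hy
    have hn : ‖(2 : ℂ) * (g y * (b y : ℂ))‖ = ‖g y‖ * (2 * b y) := by
      rw [norm_mul, norm_mul, Complex.norm_real, Real.norm_of_nonneg (by linarith)]
      simp; ring
    rw [hn]
    nlinarith [norm_nonneg (g y)]
  have hae := isOpen_Ioi.ae_eq_zero_of_integral_contDiff_smul_eq_zero hloc
    (fun b hb hb2 hb3 => by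
      have ht : IsTest fun y => (b y : ℂ) := by
        refine ⟨Complex.ofRealCLM.contDiff.comp hb, hb2.comp_left (g := Complex.ofReal) rfl, ?_⟩
        exact (closure_mono (Function.support_comp_subset (g := Complex.ofReal) rfl b)).trans hb3
      rw [← hz _ (ht.memH μ)]
      congr 1; ext x; simp [mul_comm])
  have hg0 : g = 0 := by
    refine AEEqFun.ext ?_
    filter_upwards [hae, ae_restrict_mem (μ := volume) measurableSet_Ioi,
      AEEqFun.coeFn_zero (α := ℝ) (μ := halfLine) (β := ℂ)] with x hx hx2 hx3
    rw [hx hx2, hx3]; rfl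
  rw [hg, neg_one_smul ℂ g₂, ← sub_eq_add_neg] at hg0
  exact sub_eq_zero.1 hg0

/-! ### The space `B` -/

/-- The domain of the `k`-th power of the part of `S_μ` in `Y`: `f ∈ Y`, and (for `k ≥ 1`)
`S_μ f` lies in the domain of the `(k-1)`-st power. -/
def powDomain (μ : ℝ) : ℕ → Submodule ℂ (ℝ →ₘ[halfLine] ℂ)
  | 0 => Y μ
  | k + 1 =>
    { carrier := {f | f ∈ Y μ ∧ ∃ g ∈ powDomain μ k, IsBesselImage μ f g}
      add_mem' := by
        rintro f₁ f₂ ⟨h₁, g₁, hg₁, e₁⟩ ⟨h₂, g₂, hg₂, e₂⟩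
        exact ⟨add_mem h₁ h₂, _, add_mem hg₁ hg₂, e₁.add e₂⟩
      zero_mem' := ⟨zero_mem _, 0, zero_mem _, IsBesselImage.zero μ⟩
      smul_mem' := by
        rintro c f ⟨h, g, hg, e⟩
        exact ⟨(Y μ).smul_mem c h, _, (powDomain μ k).smul_mem c hg, e.smul c⟩ }

/-- `B`, the set of `f ∈ Y` with `S_μ^k f ∈ Y` for all `k`, as a subspace of the space of
measurable functions modulo equality a.e. -/
def BSubmodule (μ : ℝ) : Submodule ℂ (ℝ →ₘ[halfLine] ℂ) := ⨅ k, powDomain μ k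

/-- The space `B`. -/
def B (μ : ℝ) : Type := BSubmodule μ

instance (μ : ℝ) : AddCommGroup (B μ) := inferInstanceAs (AddCommGroup (BSubmodule μ))

instance (μ : ℝ) : Module ℂ (B μ) := inferInstanceAs (Module ℂ (BSubmodule μ))

/-- The inclusion of `B` in the space of measurable functions modulo equality a.e. -/
def B.incl (μ : ℝ) : B μ →ₗ[ℂ] (ℝ →ₘ[halfLine] ℂ) := (BSubmodule μ).subtype

/-- The inclusion of `B` in `Y`. -/
def B.toY (μ : ℝ) : B μ →ₗ[ℂ] Y μ :=
  Submodule.inclusion (iInf_le (powDomain μ) 0 : BSubmodule μ ≤ Y μ)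

theorem B.incl_injective (μ : ℝ) : Function.Injective (B.incl μ) := Subtype.val_injective

theorem B.exists_image {μ : ℝ} (f : B μ) :
    ∃ g : B μ, IsBesselImage μ (B.incl μ f) (B.incl μ g) := by
  have hf : ∀ k, B.incl μ f ∈ powDomain μ k := fun k => (Submodule.mem_iInf _).1 f.2 k
  obtain ⟨-, g, -, hg⟩ := hf 1
  refine ⟨⟨g, (Submodule.mem_iInf _).2 fun k => ?_⟩, hg⟩
  obtain ⟨-, g', hg', e⟩ := hf (k + 1)
  rwa [hg.unique e]

/-- The part of `S_μ` in `B`; its domain is all of `B`. -/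
def besselB (μ : ℝ) : B μ →ₗ[ℂ] B μ where
  toFun f := (B.exists_image f).choose
  map_add' f g := B.incl_injective μ <| by
    have h := (B.exists_image f).choose_spec.add (B.exists_image g).choose_spec
    rw [← map_add, ← map_add] at h
    exact (B.exists_image (f + g)).choose_spec.unique h
  map_smul' c f := B.incl_injective μ <| by
    have h := (B.exists_image f).choose_spec.smul c
    rw [← map_smul, ← map_smul] at h
    exact (B.exists_image (c • f)).choose_spec.unique h

theorem besselB_spec {μ : ℝ} (f : B μ) :
    IsBesselImage μ (B.incl μ f) (B.incl μ (besselB μ f)) :=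
  (B.exists_image f).choose_spec

/-- `ρ_m(f) = max_{0 ≤ k ≤ m} ‖S_μ^k f‖_Y`. -/
def rho (μ : ℝ) : SeminormFamily ℂ (B μ) ℕ := fun m =>
  (Finset.range (m + 1)).sup fun k => (normY μ).comp (B.toY μ ∘ₗ besselB μ ^ k)

/-- The locally convex topology of `B` defined by the seminorms `ρ_m`. -/
instance (μ : ℝ) : TopologicalSpace (B μ) := (rho μ).moduleFilterBasis.topology

end

/-! ### Fréchet spaces and non-negative operators -/

/-- Fréchet spaces: metrizable complete locally convex topological vector spaces. -/
structure IsFrechetSpace (E : Type*) [AddCommGroup E] [Module ℂ E] [TopologicalSpace E] :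
    Prop where
  isTopologicalAddGroup : IsTopologicalAddGroup E
  continuousSMul : ContinuousSMul ℂ E
  locallyConvexSpace : LocallyConvexSpace ℝ E
  metrizableSpace : TopologicalSpace.MetrizableSpace E
  completeSpace : @CompleteSpace E (IsTopologicalAddGroup.rightUniformSpace E)

/-- A linear operator `A : D(A) ⊆ E → E` on a locally convex space is non-negative if
`(-∞, 0)` lies in its resolvent set and the operators `t (t + A)⁻¹`, `t > 0`, are
equicontinuous. (The second clause is equicontinuity, written with `y = (t + A) x`; it contains
the continuity of each `(t + A)⁻¹`.) -/
structure IsNonnegativeOperator {E : Type*} [AddCommGroup E] [Module ℂ E] [TopologicalSpace E]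
    (A : E →ₗ.[ℂ] E) : Prop where
  bijective : ∀ t : ℝ, 0 < t →
    Function.Bijective fun x : A.domain => (t : ℂ) • (x : E) + A x
  equicontinuous : ∀ U ∈ 𝓝 (0 : E), ∃ V ∈ 𝓝 (0 : E), ∀ t : ℝ, 0 < t →
    ∀ x : A.domain, (t : ℂ) • (x : E) + A x ∈ V → (t : ℂ) • (x : E) ∈ U

end Bessel

namespace Bessel

/-! ### Weights -/

/-! Everything rests on one fact about `Y`: for every `t > 0` the operator `t - S_μ` maps its domain
in `Y` bijectively onto `Y`, and `t (t - S_μ)⁻¹` is a contraction (`hasContractiveResolvent`). The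
resolvent commutes with `S_μ`, so the contraction estimate passes to every `ρ_m`, uniformly in `t`;
this is equicontinuity, and a bootstrap shows that the resolvent preserves `B`. Completeness of `B`
follows from that of `Y` and from closedness of `S_μ` in `Y`: the elements of `H_μ` and their images
under `S_μ` are `O(x^(μ+1/2))`, hence define continuous functionals on `L^1(s r)`.

For the resolvent write `φ = x^(μ+1/2) ψ`. Then `S_μ` becomes `L = D² + (2μ+1) x⁻¹ D`, symmetric for
`x^(2μ+1) dx`. The equation `L u = l u` has a positive solution `p` regular at `0` (a power series)
and a rapidly decreasing one `q`, given by reduction of order. They yield the symmetric nonnegative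
Green function `p(min) q(max)`. Lagrange's identity represents any `ψ` coming from `H_μ` as the
Green potential of `l ψ - L ψ` (`greenK_representation`). For the constant `1/l` this says that the
resolvent kernel sends `x^(μ+1/2)` to `l⁻¹ x^(μ+1/2)`. As `1/r = x^(μ+1/2)` and `s r =
x^(μ+1/2)/c_μ`, Schur's test with this single function bounds the resolvent by `l⁻¹` both in
`L^∞(r)` and, by symmetry of the kernel, in `L^1(s r)`. Fubini and the representation formula show
that the potential solves the equation in `H_μ'` (`exists_solution_Y`).

Uniqueness is by duality: for a test function `χ`, variation of constants solves `l φ - S_μ φ = χ`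
with `φ ∈ H_μ` (`IsTest.exists_memH`), because the solution is a multiple of `p` near `0` and of `q`
near infinity. An `f ∈ Y` with `S_μ f = l f` therefore annihilates every test function. -/

theorem cConst_pos {μ : ℝ} (hμ : -1 / 2 < μ) : 0 < cConst μ :=
  mul_pos (Real.rpow_pos_of_pos two_pos _) (Real.Gamma_pos_of_pos (by linarith))

theorem rWeight_pos (μ : ℝ) {x : ℝ} (hx : 0 < x) : 0 < rWeight μ x := Real.rpow_pos_of_pos hx _

theorem rWeight_mul_rpow (μ : ℝ) {x : ℝ} (hx : 0 < x) : rWeight μ x * x ^ (μ + 1 / 2) = 1 := by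
  rw [rWeight, ← Real.rpow_add hx]; ring_nf; simp

theorem sWeight_mul_rWeight (μ : ℝ) {x : ℝ} (hx : 0 < x) :
    sWeight μ x * rWeight μ x = x ^ (μ + 1 / 2) / cConst μ := by
  rw [sWeight, rWeight, div_mul_eq_mul_div, ← Real.rpow_add hx]; ring_nf

theorem rpow_mul_rpow_half (μ : ℝ) {x : ℝ} (hx : 0 < x) :
    x ^ (μ + 1 / 2) * x ^ (μ + 1 / 2) = x ^ (2 * μ + 1) := by
  rw [← Real.rpow_add hx]; ring_nf

theorem hasDerivAt_ofReal_rpow (a : ℝ) {x : ℝ} (hx : 0 < x) :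
    HasDerivAt (fun y : ℝ => ((y ^ a : ℝ) : ℂ)) ((x ^ a : ℝ) * (a / x)) x := by
  convert (Real.hasDerivAt_rpow_const (p := a) (Or.inl hx.ne')).ofReal_comp using 1
  rw [Real.rpow_sub_one hx.ne']; push_cast; ring

theorem contDiffOn_ofReal_rpow (a : ℝ) :
    ContDiffOn ℝ ∞ (fun x : ℝ => ((x ^ a : ℝ) : ℂ)) (Ioi 0) := by
  have h : ContDiffOn ℝ ∞ (fun x : ℝ => x ^ a) (Ioi 0) := fun x hx =>
    (Real.contDiffAt_rpow_const_of_ne (ne_of_gt hx)).contDiffWithinAt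
  exact Complex.ofRealCLM.contDiff.comp_contDiffOn h

/-! ### The operator `x⁻¹ D` -/

theorem contDiffOn_xInvD {ψ : ℝ → ℂ} (h : ContDiffOn ℝ ∞ ψ (Ioi 0)) :
    ContDiffOn ℝ ∞ (xInvD ψ) (Ioi 0) :=
  contDiffOn_inv.mul ((contDiffOn_infty_iff_deriv_of_isOpen isOpen_Ioi).1 h).2

theorem contDiffOn_xInvD_iterate {ψ : ℝ → ℂ} (h : ContDiffOn ℝ ∞ ψ (Ioi 0)) (k : ℕ) :
    ContDiffOn ℝ ∞ (xInvD^[k] ψ) (Ioi 0) := by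
  induction k with
  | zero => exact h
  | succ k ih => rw [Function.iterate_succ_apply']; exact contDiffOn_xInvD ih

theorem hasDerivAt_xInvD {ψ : ℝ → ℂ} (h : ContDiffOn ℝ ∞ ψ (Ioi 0)) {x : ℝ} (hx : 0 < x) :
    HasDerivAt ψ (x * xInvD ψ x) x := by
  have hx' : (x : ℂ) ≠ 0 := by exact_mod_cast hx.ne'
  have := ((h.differentiableOn (by simp)).differentiableAt (Ioi_mem_nhds hx)).hasDerivAt
  rwa [show (x : ℂ) * xInvD ψ x = deriv ψ x from mul_inv_cancel_left₀ hx' _]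

theorem xInvD_eq_of_hasDerivAt {ψ : ℝ → ℂ} {c : ℂ} {x : ℝ} (hx : 0 < x)
    (h : HasDerivAt ψ (x * c) x) : xInvD ψ x = c := by
  have hx' : (x : ℂ) ≠ 0 := by exact_mod_cast hx.ne'
  rw [xInvD, h.deriv, inv_mul_cancel_left₀ hx']

theorem xInvD_congr {ψ χ : ℝ → ℂ} {U : Set ℝ} (hU : IsOpen U) (h : EqOn ψ χ U) :
    EqOn (xInvD ψ) (xInvD χ) U := fun x hx => by
  rw [xInvD, xInvD, (eventuallyEq_of_mem (hU.mem_nhds hx) h).deriv_eq]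

theorem xInvD_iterate_congr {ψ χ : ℝ → ℂ} {U : Set ℝ} (hU : IsOpen U) (h : EqOn ψ χ U) (k : ℕ) :
    EqOn (xInvD^[k] ψ) (xInvD^[k] χ) U := by
  induction k with
  | zero => exact h
  | succ k ih => simp only [Function.iterate_succ_apply']; exact xInvD_congr hU ih

/-- `ψ₁ = x⁻¹ D ψ` and `ψ₂ = x⁻¹ D ψ₁` on `(0, ∞)`. -/
def IsRadialJet (ψ ψ₁ ψ₂ : ℝ → ℂ) : Prop :=
  ∀ x : ℝ, 0 < x → HasDerivAt ψ (x * ψ₁ x) x ∧ HasDerivAt ψ₁ (x * ψ₂ x) x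

theorem isRadialJet_xInvD {ψ : ℝ → ℂ} (h : ContDiffOn ℝ ∞ ψ (Ioi 0)) :
    IsRadialJet ψ (xInvD ψ) (xInvD (xInvD ψ)) := fun _ hx =>
  ⟨hasDerivAt_xInvD h hx, hasDerivAt_xInvD (contDiffOn_xInvD h) hx⟩

/-- Conjugation by `x^(μ+1/2)` removes the potential, since `(μ+1/2)(μ-1/2) = (4μ²-1)/4`. What
remains is `D² + (2μ+1) x⁻¹ D`, and `ψ'' = ψ₁ + x² ψ₂` puts it in the form used here. -/
theorem besselDiff_of_isRadialJet {μ : ℝ} {φ ψ ψ₁ ψ₂ : ℝ → ℂ} (hj : IsRadialJet ψ ψ₁ ψ₂)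
    (hφ : ∀ x : ℝ, 0 < x → φ x = (x ^ (μ + 1 / 2) : ℝ) * ψ x) {x : ℝ} (hx : 0 < x) :
    besselDiff μ φ x =
      (x ^ (μ + 1 / 2) : ℝ) * (x ^ 2 * ψ₂ x + (2 * μ + 2) * ψ₁ x) := by
  have d1 : ∀ y : ℝ, 0 < y → deriv φ y =
      (y ^ (μ + 1 / 2) : ℝ) * ((μ + 1 / 2) * (y : ℂ)⁻¹ * ψ y + y * ψ₁ y) := by
    intro y hy
    have h := (hasDerivAt_ofReal_rpow (μ + 1 / 2) hy).mul (hj y hy).1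
    rw [(eventuallyEq_of_mem (Ioi_mem_nhds hy) fun z hz => hφ z hz).deriv_eq]
    refine h.deriv.trans ?_
    push_cast; ring
  have hx' : (x : ℂ) ≠ 0 := by exact_mod_cast hx.ne'
  have hid : HasDerivAt (fun y : ℝ => (y : ℂ)) 1 x := (hasDerivAt_id x).ofReal_comp
  have h2 := (hasDerivAt_ofReal_rpow (μ + 1 / 2) hx).mul
    ((((hid.inv hx').const_mul ((μ : ℂ) + 1 / 2)).mul (hj x hx).1).add (hid.mul (hj x hx).2))
  have d2 : deriv (deriv φ) x = _ :=
    (eventuallyEq_of_mem (Ioi_mem_nhds hx) fun z hz => d1 z hz).deriv_eq.trans h2.deriv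
  rw [besselDiff, d2, hφ x hx]
  simp only [Pi.add_apply, Pi.mul_apply, Pi.inv_apply]
  push_cast
  field_simp
  ring

/-- The function `x^(-μ-1/2) φ` in the definition of `H_μ` is bounded, together with its first two
derivatives, and it determines `S_μ φ`. -/
theorem MemH.exists_isRadialJet {μ : ℝ} {φ : ℝ → ℂ} (hφ : MemH μ φ) :
    ∃ ψ ψ₁ ψ₂ : ℝ → ℂ, IsRadialJet ψ ψ₁ ψ₂ ∧ ContinuousOn ψ₂ (Ioi 0) ∧
      (∃ C, ∀ x : ℝ, 0 < x → ‖ψ x‖ ≤ C ∧ ‖ψ₁ x‖ ≤ C ∧ ‖(x : ℂ) ^ 2 * ψ₂ x‖ ≤ C) ∧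
      (∀ x : ℝ, 0 < x → φ x = (x ^ (μ + 1 / 2) : ℝ) * ψ x) := by
  have hs := (contDiffOn_rWeight μ).mul hφ.1
  set ψ : ℝ → ℂ := fun x => (rWeight μ x : ℂ) * φ x
  refine ⟨ψ, xInvD ψ, xInvD (xInvD ψ), isRadialJet_xInvD hs,
    (contDiffOn_xInvD (contDiffOn_xInvD hs)).continuousOn, ?_, fun x hx => ?_⟩
  · obtain ⟨C₀, h₀⟩ := hφ.2 0 0
    obtain ⟨C₁, h₁⟩ := hφ.2 0 1
    obtain ⟨C₂, h₂⟩ := hφ.2 2 2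
    refine ⟨max C₀ (max C₁ C₂), fun x hx => ⟨?_, ?_, ?_⟩⟩
    · exact le_trans (by simpa [ψ] using h₀ x hx) (le_max_left _ _)
    · exact le_trans (by simpa using h₁ x hx) ((le_max_left _ _).trans (le_max_right _ _))
    · exact le_trans (by simpa using h₂ x hx) ((le_max_right _ _).trans (le_max_right _ _))
  · have := rWeight_mul_rpow μ hx
    simp only [ψ]
    rw [← mul_assoc, mul_comm _ (rWeight μ x : ℂ), ← Complex.ofReal_mul, this]; simp

theorem MemH.continuousOn {μ : ℝ} {φ : ℝ → ℂ} (hφ : MemH μ φ) : ContinuousOn φ (Ioi 0) :=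
  hφ.1.continuousOn

theorem MemH.exists_bound {μ : ℝ} {φ : ℝ → ℂ} (hφ : MemH μ φ) :
    ∃ C, ∀ x : ℝ, 0 < x → ‖φ x‖ ≤ C * x ^ (μ + 1 / 2) := by
  obtain ⟨ψ, ψ₁, ψ₂, -, -, ⟨C, hC⟩, h⟩ := hφ.exists_isRadialJet
  refine ⟨C, fun x hx => ?_⟩
  have := Real.rpow_pos_of_pos hx (μ + 1 / 2)
  rw [h x hx, norm_mul, Complex.norm_real, Real.norm_of_nonneg this.le, mul_comm]
  exact mul_le_mul_of_nonneg_right (hC x hx).1 this.le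

theorem MemH.continuousOn_besselDiff {μ : ℝ} {φ : ℝ → ℂ} (hφ : MemH μ φ) :
    ContinuousOn (besselDiff μ φ) (Ioi 0) := by
  obtain ⟨ψ, ψ₁, ψ₂, hj, hc, -, h⟩ := hφ.exists_isRadialJet
  have h1 : ContinuousOn ψ₁ (Ioi 0) := fun x hx =>
    (hj x hx).2.continuousAt.continuousWithinAt
  refine ContinuousOn.congr (f := fun x : ℝ => ((x ^ (μ + 1 / 2) : ℝ) : ℂ) *
    (x ^ 2 * ψ₂ x + (2 * μ + 2) * ψ₁ x)) ?_ fun x hx => besselDiff_of_isRadialJet hj h hx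
  exact (contDiffOn_ofReal_rpow _).continuousOn.mul
    (((Complex.continuous_ofReal.pow 2).continuousOn.mul hc).add (continuousOn_const.mul h1))

theorem MemH.exists_bound_besselDiff {μ : ℝ} {φ : ℝ → ℂ} (hφ : MemH μ φ) :
    ∃ C, ∀ x : ℝ, 0 < x → ‖besselDiff μ φ x‖ ≤ C * x ^ (μ + 1 / 2) := by
  obtain ⟨ψ, ψ₁, ψ₂, hj, -, ⟨C, hC⟩, h⟩ := hφ.exists_isRadialJet
  refine ⟨C + ‖(2 * μ + 2 : ℂ)‖ * C, fun x hx => ?_⟩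
  have := Real.rpow_pos_of_pos hx (μ + 1 / 2)
  rw [besselDiff_of_isRadialJet hj h hx, norm_mul, Complex.norm_real,
    Real.norm_of_nonneg this.le, mul_comm]
  refine mul_le_mul_of_nonneg_right ((norm_add_le _ _).trans (add_le_add (hC x hx).2.2 ?_)) this.le
  rw [norm_mul]
  exact mul_le_mul_of_nonneg_left (hC x hx).2.1 (norm_nonneg _)

/-! ### The pairing of `Y` with functions dominated by `x^(μ+1/2)` -/

theorem normY_apply (μ : ℝ) (f : Y μ) : normY μ f =
    max (eLpNorm (fun x => ((sWeight μ x * rWeight μ x : ℝ) : ℂ) * f.1 x) 1 halfLine).toReal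
      (eLpNorm (fun x => (rWeight μ x : ℂ) * f.1 x) ∞ halfLine).toReal := rfl

theorem ae_halfLine_pos : ∀ᵐ x ∂halfLine, 0 < x := ae_restrict_mem measurableSet_Ioi

theorem integrable_rpow_mul_of_mem_Y {μ : ℝ} (hμ : -1 / 2 < μ) {f : ℝ →ₘ[halfLine] ℂ}
    (hf : f ∈ Y μ) :
    Integrable (fun x => ((x ^ (μ + 1 / 2) : ℝ) : ℂ) * f x) halfLine := by
  have h := (memLp_one_iff_integrable.1 hf.1).const_mul (cConst μ : ℂ)
  refine h.congr ?_
  filter_upwards [ae_halfLine_pos] with x hx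
  have := (cConst_pos hμ).ne'
  rw [sWeight_mul_rWeight μ hx, ← mul_assoc, ← Complex.ofReal_mul]
  congr 3
  field_simp

theorem integrable_pair {μ : ℝ} (hμ : -1 / 2 < μ) {f : ℝ →ₘ[halfLine] ℂ} (hf : f ∈ Y μ)
    {φ : ℝ → ℂ} (hφ : ContinuousOn φ (Ioi 0)) {C : ℝ}
    (hC : ∀ x : ℝ, 0 < x → ‖φ x‖ ≤ C * x ^ (μ + 1 / 2)) :
    Integrable (fun x => f x * φ x) halfLine := by
  refine ((integrable_rpow_mul_of_mem_Y hμ hf).const_mul (C : ℂ)).mono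
    (f.aestronglyMeasurable.mul (hφ.aestronglyMeasurable measurableSet_Ioi)) ?_
  filter_upwards [ae_halfLine_pos] with x hx
  have h1 := Real.rpow_pos_of_pos hx (μ + 1 / 2)
  have h2 := hC x hx
  rw [norm_mul, norm_mul, norm_mul, Complex.norm_real, Complex.norm_real,
    Real.norm_of_nonneg h1.le, Real.norm_eq_abs]
  calc ‖f x‖ * ‖φ x‖ ≤ ‖f x‖ * (|C| * x ^ (μ + 1 / 2)) := by
        gcongr
        exact h2.trans (mul_le_mul_of_nonneg_right (le_abs_self C) h1.le)
    _ = _ := by ring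

/-- Only the `L^1` half of the norm is needed, because `s r = x^(μ+1/2) / c_μ`. -/
theorem norm_pair_le {μ : ℝ} (hμ : -1 / 2 < μ) (f : Y μ)
    {φ : ℝ → ℂ} {C : ℝ} (hC0 : 0 ≤ C)
    (hC : ∀ x : ℝ, 0 < x → ‖φ x‖ ≤ C * x ^ (μ + 1 / 2)) :
    ‖∫ x, f.1 x * φ x ∂halfLine‖ ≤ C * cConst μ * normY μ f := by
  have hc := cConst_pos hμ
  have hi := memLp_one_iff_integrable.1 f.2.1
  have e : ∫ x, ‖((sWeight μ x * rWeight μ x : ℝ) : ℂ) * f.1 x‖ ∂halfLine =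
      (eLpNorm (fun x => ((sWeight μ x * rWeight μ x : ℝ) : ℂ) * f.1 x) 1 halfLine).toReal := by
    rw [eLpNorm_one_eq_lintegral_enorm, integral_norm_eq_lintegral_enorm hi.1]
  calc ‖∫ x, f.1 x * φ x ∂halfLine‖
      ≤ ∫ x, (C * cConst μ) * ‖((sWeight μ x * rWeight μ x : ℝ) : ℂ) * f.1 x‖ ∂halfLine := by
        refine norm_integral_le_of_norm_le (hi.norm.const_mul _) ?_
        filter_upwards [ae_halfLine_pos] with x hx
        have h1 := Real.rpow_pos_of_pos hx (μ + 1 / 2)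
        rw [sWeight_mul_rWeight μ hx, norm_mul, norm_mul, Complex.norm_real,
          Real.norm_of_nonneg (by positivity)]
        calc ‖f.1 x‖ * ‖φ x‖ ≤ ‖f.1 x‖ * (C * x ^ (μ + 1 / 2)) := by gcongr; exact hC x hx
          _ = _ := by field_simp
    _ = C * cConst μ *
        (eLpNorm (fun x => ((sWeight μ x * rWeight μ x : ℝ) : ℂ) * f.1 x) 1 halfLine).toReal := by
        rw [integral_const_mul, e]
    _ ≤ _ := by
        rw [normY_apply]
        gcongr
        exact le_max_left _ _

/-! ### Completeness of `Y` -/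

/-- Multiplication by `w` is isometric into the complete space `L^p`. As `w` may vanish, the limit
`h` is not divided by `w` here; any `g` with `w g = h` will do. Convergence in measure is recorded
so that limits for different `p` can be compared. -/
theorem exists_limit_weightedLp {w : ℝ → ℝ} {p : ℝ≥0∞} [hp : Fact (1 ≤ p)]
    (f : ℕ → weightedLp w p)
    (hf : ∀ ε > 0, ∃ N, ∀ m ≥ N, ∀ n ≥ N, weightedNorm w p hp.out (f m - f n) < ε) :
    ∃ h : Lp ℂ p halfLine,
      TendstoInMeasure halfLine (fun n x => (w x : ℂ) * (f n).1 x) atTop h ∧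
      ∀ g : ℝ →ₘ[halfLine] ℂ, (fun x => (w x : ℂ) * g x) =ᵐ[halfLine] h →
        ∃ hg : g ∈ weightedLp w p,
          Tendsto (fun n => weightedNorm w p hp.out (f n - ⟨g, hg⟩)) atTop (𝓝 0) := by
  have hm : ∀ g : weightedLp w p, MemLp (fun x => (w x : ℂ) * g.1 x) p halfLine := fun g => g.2
  have hd : ∀ g g' : weightedLp w p,
      dist ((hm g).toLp) ((hm g').toLp) = weightedNorm w p hp.out (g - g') := by
    intro g g'
    rw [dist_eq_norm, ← MemLp.toLp_sub, Lp.norm_toLp]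
    refine congrArg ENNReal.toReal (eLpNorm_congr_ae ?_)
    filter_upwards [AEEqFun.coeFn_sub g.1 g'.1] with x hx
    simp only [Pi.sub_apply, AddSubgroupClass.coe_sub, hx]
    ring
  have hc : CauchySeq fun n => (hm (f n)).toLp := by
    refine Metric.cauchySeq_iff.2 fun ε hε => ?_
    obtain ⟨N, hN⟩ := hf ε hε
    exact ⟨N, fun m hm n hn => by rw [hd]; exact hN m hm n hn⟩
  obtain ⟨h, hh⟩ := cauchySeq_tendsto_of_complete hc
  refine ⟨h, (tendstoInMeasure_of_tendsto_Lp hh).congr_left fun n => MemLp.coeFn_toLp _, ?_⟩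
  intro g hg
  have hgm : g ∈ weightedLp w p := (memLp_congr_ae hg).2 (Lp.memLp h)
  refine ⟨hgm, ?_⟩
  have e : (hm ⟨g, hgm⟩).toLp = h := Lp.ext ((MemLp.coeFn_toLp _).trans hg)
  have := tendsto_iff_dist_tendsto_zero.1 hh
  rw [← e] at this
  exact this.congr fun n => hd _ _

/-- The limits `h₁` of `s r fₙ` and `h₂` of `r fₙ` satisfy `h₁ = s h₂` a.e., so that `h₂ / r` is the
limit for both norms. -/
theorem exists_limit_Y {μ : ℝ} (f : ℕ → Y μ)
    (hf : ∀ ε > 0, ∃ N, ∀ m ≥ N, ∀ n ≥ N, normY μ (f m - f n) < ε) :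
    ∃ g : Y μ, Tendsto (fun n => normY μ (f n - g)) atTop (𝓝 0) := by
  obtain ⟨h₁, t₁, l₁⟩ := exists_limit_weightedLp (hp := ⟨le_rfl⟩)
    (fun n => (Submodule.inclusion inf_le_left (f n) :
      weightedLp (fun x => sWeight μ x * rWeight μ x) 1))
    (fun ε hε => (hf ε hε).imp fun N hN m hm n hn =>
      lt_of_le_of_lt (le_max_left _ _) (hN m hm n hn))
  obtain ⟨h₂, t₂, l₂⟩ := exists_limit_weightedLp (hp := ⟨le_top⟩)
    (fun n => (Submodule.inclusion inf_le_right (f n) : weightedLp (rWeight μ) ∞))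
    (fun ε hε => (hf ε hε).imp fun N hN m hm n hn =>
      lt_of_le_of_lt (le_max_right _ _) (hN m hm n hn))
  have key : ∀ᵐ x ∂halfLine, h₁ x = (sWeight μ x : ℂ) * h₂ x := by
    obtain ⟨φ, hφ, a₁⟩ := t₁.exists_seq_tendsto_ae
    -- The second extraction starts from the first subsequence, so both sequences converge a.e.
    -- along the composite.
    obtain ⟨φ', hφ', a₂⟩ := TendstoInMeasure.exists_seq_tendsto_ae
      (fun ε hε => (t₂ ε hε).comp hφ.tendsto_atTop)
    filter_upwards [a₁, a₂] with x b₁ b₂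
    have c₁ := b₁.comp hφ'.tendsto_atTop
    have c₂ := b₂.const_mul (sWeight μ x : ℂ)
    refine tendsto_nhds_unique c₁ (c₂.congr fun n => ?_)
    simp only [Function.comp_apply, Complex.ofReal_mul, mul_assoc]
    rfl
  have hr : AEStronglyMeasurable (fun x => ((rWeight μ x)⁻¹ : ℂ) * h₂ x) halfLine := by
    refine AEStronglyMeasurable.mul ?_ (Lp.aestronglyMeasurable h₂)
    have : ContinuousOn (fun x : ℝ => ((rWeight μ x)⁻¹ : ℂ)) (Ioi 0) :=
      (contDiffOn_rWeight μ).continuousOn.inv₀ fun x hx => by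
        exact_mod_cast (rWeight_pos μ hx).ne'
    exact this.aestronglyMeasurable measurableSet_Ioi
  set g := AEEqFun.mk _ hr
  have hg : ∀ᵐ x ∂halfLine, (rWeight μ x : ℂ) * g x = h₂ x := by
    filter_upwards [AEEqFun.coeFn_mk _ hr, ae_halfLine_pos] with x hx hx0
    have : (rWeight μ x : ℂ) ≠ 0 := by exact_mod_cast (rWeight_pos μ hx0).ne'
    rw [hx, mul_inv_cancel_left₀ this]
  obtain ⟨m₂, L₂⟩ := l₂ g hg
  obtain ⟨m₁, L₁⟩ := l₁ g (by
    filter_upwards [hg, key] with x e₁ e₂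
    rw [e₂, ← e₁, Complex.ofReal_mul, mul_assoc])
  refine ⟨⟨g, m₁, m₂⟩, ?_⟩
  have := L₁.max L₂
  rw [max_self] at this
  exact this

theorem eq_zero_of_normY_eq_zero {μ : ℝ} {f : Y μ} (h : normY μ f = 0) : f = 0 := by
  rw [normY_apply] at h
  have h2 : (eLpNorm (fun x => (rWeight μ x : ℂ) * f.1 x) ∞ halfLine).toReal = 0 :=
    le_antisymm (h ▸ le_max_right _ _) ENNReal.toReal_nonneg
  have hm : MemLp (fun x => (rWeight μ x : ℂ) * f.1 x) ∞ halfLine := f.2.2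
  have h3 := (ENNReal.toReal_eq_zero_iff _).1 h2 |>.resolve_right hm.2.ne
  have h4 := (eLpNorm_eq_zero_iff hm.1 (by simp)).1 h3
  refine Subtype.ext (AEEqFun.ext ?_)
  filter_upwards [h4, ae_halfLine_pos, AEEqFun.coeFn_zero (α := ℝ) (μ := halfLine) (β := ℂ)]
    with x hx hx0 hz
  have : (rWeight μ x : ℂ) ≠ 0 := by exact_mod_cast (rWeight_pos μ hx0).ne'
  rw [ZeroMemClass.coe_zero, hz]
  exact (mul_eq_zero.1 hx).resolve_left this

/-! ### Closedness of `S_μ` in `Y` -/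

theorem tendsto_pair {μ : ℝ} (hμ : -1 / 2 < μ) {f : ℕ → Y μ} {g : Y μ}
    (h : Tendsto (fun n => normY μ (f n - g)) atTop (𝓝 0))
    {φ : ℝ → ℂ} (hφ : ContinuousOn φ (Ioi 0)) {C : ℝ}
    (hC : ∀ x : ℝ, 0 < x → ‖φ x‖ ≤ C * x ^ (μ + 1 / 2)) :
    Tendsto (fun n => ∫ x, (f n).1 x * φ x ∂halfLine) atTop (𝓝 (∫ x, g.1 x * φ x ∂halfLine)) := by
  have hC0 : 0 ≤ C := by simpa using (norm_nonneg _).trans (hC 1 one_pos)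
  refine tendsto_iff_norm_sub_tendsto_zero.2 ?_
  refine squeeze_zero (fun _ => norm_nonneg _) (fun n => ?_)
    (by simpa using h.const_mul (C * cConst μ))
  rw [← integral_sub (integrable_pair hμ (f n).2 hφ hC) (integrable_pair hμ g.2 hφ hC)]
  refine le_trans (le_of_eq ?_) (norm_pair_le hμ (f n - g) hC0 hC)
  congr 1
  refine integral_congr_ae ?_
  filter_upwards [AEEqFun.coeFn_sub (f n).1 g.1] with x hx
  simp only [AddSubgroupClass.coe_sub, hx, Pi.sub_apply]
  ring

/-- Both sides of the defining identity are continuous for the norm of `Y`, as `φ` and `S_μ φ` are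
`O(x^(μ+1/2))`. -/
theorem isBesselImage_of_tendsto {μ : ℝ} (hμ : -1 / 2 < μ) {f f' : ℕ → Y μ} {g g' : Y μ}
    (hff : ∀ n, IsBesselImage μ (f n).1 (f' n).1)
    (h : Tendsto (fun n => normY μ (f n - g)) atTop (𝓝 0))
    (h' : Tendsto (fun n => normY μ (f' n - g')) atTop (𝓝 0)) :
    IsBesselImage μ g.1 g'.1 := by
  intro φ hφ
  obtain ⟨C, hC⟩ := hφ.exists_bound
  obtain ⟨C', hC'⟩ := hφ.exists_bound_besselDiff
  refine ⟨integrable_pair hμ g'.2 hφ.continuousOn hC,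
    integrable_pair hμ g.2 hφ.continuousOn_besselDiff hC', ?_⟩
  refine tendsto_nhds_unique (tendsto_pair hμ h' hφ.continuousOn hC) ?_
  exact (tendsto_pair hμ h hφ.continuousOn_besselDiff hC').congr fun n => (hff n φ hφ).2.2.symm

theorem IsBesselImage.sub {μ : ℝ} {f₁ g₁ f₂ g₂ : ℝ →ₘ[halfLine] ℂ}
    (h₁ : IsBesselImage μ f₁ g₁) (h₂ : IsBesselImage μ f₂ g₂) :
    IsBesselImage μ (f₁ - f₂) (g₁ - g₂) := by
  have h := h₁.add (h₂.smul (-1))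
  rwa [neg_one_smul ℂ f₂, neg_one_smul ℂ g₂, ← sub_eq_add_neg, ← sub_eq_add_neg] at h

/-! ### The space `B` is a Fréchet space -/

theorem withSeminorms_rho (μ : ℝ) : WithSeminorms (rho μ) := ⟨rfl⟩

theorem normY_pow_le_rho (μ : ℝ) {k m : ℕ} (h : k ≤ m) (f : B μ) :
    normY μ (B.toY μ ((besselB μ ^ k) f)) ≤ rho μ m f :=
  Finset.le_sup (f := fun k => (normY μ).comp (B.toY μ ∘ₗ besselB μ ^ k))
    (Finset.mem_range_succ_iff.2 h) f

theorem rho_le {μ : ℝ} {m : ℕ} {f : B μ} {a : ℝ} (ha : 0 ≤ a)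
    (h : ∀ k ≤ m, normY μ (B.toY μ ((besselB μ ^ k) f)) ≤ a) : rho μ m f ≤ a :=
  Seminorm.finset_sup_apply_le ha fun k hk => h k (Finset.mem_range_succ_iff.1 hk)

theorem toY_injective (μ : ℝ) : Function.Injective (B.toY μ) := fun _ _ h =>
  B.incl_injective μ (congrArg Subtype.val h :)

theorem besselB_eq_of_isBesselImage {μ : ℝ} {f g : B μ}
    (h : IsBesselImage μ (B.incl μ f) (B.incl μ g)) : besselB μ f = g :=
  B.incl_injective μ ((besselB_spec f).unique h)

theorem exists_limit_B {μ : ℝ} (hμ : -1 / 2 < μ) (f : ℕ → B μ)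
    (hf : ∀ k, ∀ ε > 0, ∃ N, ∀ m ≥ N, ∀ n ≥ N, rho μ k (f m - f n) < ε) :
    ∃ g : B μ, Tendsto f atTop (𝓝 g) := by
  have hY : ∀ k, ∃ g : Y μ,
      Tendsto (fun n => normY μ (B.toY μ ((besselB μ ^ k) (f n)) - g)) atTop (𝓝 0) := by
    refine fun k => exists_limit_Y _ fun ε hε => (hf k ε hε).imp fun N hN m hm n hn => ?_
    have e : B.toY μ ((besselB μ ^ k) (f m)) - B.toY μ ((besselB μ ^ k) (f n)) =
        B.toY μ ((besselB μ ^ k) (f m - f n)) := by rw [map_sub, map_sub]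
    rw [e]
    exact (normY_pow_le_rho μ le_rfl _).trans_lt (hN m hm n hn)
  choose g hg using hY
  have him : ∀ k, IsBesselImage μ (g k).1 (g (k + 1)).1 := fun k => by
    refine isBesselImage_of_tendsto hμ (fun n => ?_) (hg k) (hg (k + 1))
    rw [pow_succ']
    exact besselB_spec _
  -- Membership is proved for all `k` at once: level `j + 1` at `k` rests on level `j` at `k + 1`.
  have hdom : ∀ j k, (g k).1 ∈ powDomain μ j := by
    intro j
    induction j with
    | zero => exact fun k => (g k).2
    | succ j ih => exact fun k => ⟨(g k).2, _, ih (k + 1), him k⟩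
  let b : ℕ → B μ := fun k => ⟨(g k).1, (Submodule.mem_iInf _).2 fun j => hdom j k⟩
  have hb : ∀ k, (besselB μ ^ k) (b 0) = b k := by
    intro k
    induction k with
    | zero => rfl
    | succ k ih => rw [pow_succ', Module.End.mul_apply, ih]; exact besselB_eq_of_isBesselImage (him k)
  refine ⟨b 0, ((withSeminorms_rho μ).tendsto_nhds f (b 0)).2 fun m ε hε => ?_⟩
  have hev : ∀ᶠ n in atTop, ∀ k ∈ Finset.range (m + 1),
      normY μ (B.toY μ ((besselB μ ^ k) (f n)) - g k) < ε / 2 :=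
    (Finset.eventually_all _).2 fun k _ => (hg k).eventually_lt_const (half_pos hε)
  filter_upwards [hev] with n hn
  refine (rho_le (half_pos hε).le fun k hk => ?_).trans_lt (half_lt_self hε)
  rw [map_sub, map_sub, hb]
  exact (hn k (Finset.mem_range_succ_iff.2 hk)).le

theorem isFrechetSpace_B {μ : ℝ} (hμ : -1 / 2 < μ) : IsFrechetSpace (B μ) := by
  have hw := withSeminorms_rho μ
  have hg := hw.topologicalAddGroup
  let := IsTopologicalAddGroup.rightUniformSpace (B μ)
  have : IsUniformAddGroup (B μ) := isUniformAddGroup_of_addCommGroup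
  have := hw.firstCountableTopology
  have : (uniformity (B μ)).IsCountablyGenerated :=
    IsUniformAddGroup.uniformity_countably_generated
  -- `ρ_0` is the norm of `Y` and already separates points.
  have : T1Space (B μ) := hw.T1_of_separating fun x hx => ⟨0, fun h => hx <| by
    have h0 := normY_pow_le_rho μ (le_refl 0) x
    rw [h] at h0
    exact toY_injective μ ((eq_zero_of_normY_eq_zero (le_antisymm h0 (apply_nonneg _ _))).trans
      (map_zero _).symm)⟩
  refine ⟨hg, hw.continuousSMul, hw.toLocallyConvexSpace, UniformSpace.metrizableSpace, ?_⟩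
  -- There are countably many seminorms, so the uniformity is countably generated and Cauchy
  -- sequences suffice.
  refine UniformSpace.complete_of_cauchySeq_tendsto fun u hu => exists_limit_B hμ u fun k ε hε => ?_
  have hball : (rho μ k).ball 0 ε ∈ 𝓝 (0 : B μ) :=
    (hw.mem_nhds_iff 0 _).2 ⟨{k}, ε, hε, by simp⟩
  have hU : {p : B μ × B μ | p.2 - p.1 ∈ (rho μ k).ball 0 ε} ∈ uniformity (B μ) := by
    rw [uniformity_eq_comap_nhds_zero]
    exact preimage_mem_comap hball
  have := cauchySeq_iff.1 hu _ hU
  obtain ⟨N, hN⟩ := this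
  refine ⟨N, fun m hm n hn => ?_⟩
  -- The indices are exchanged because the entourage is written with `p.2 - p.1`.
  have := hN n hn m hm
  simpa [Seminorm.mem_ball] using this

/-- Continuity is the bound `ρ_m (S_μ f) ≤ ρ_{m+1} f`. -/
theorem continuous_neg_besselB (μ : ℝ) : Continuous (-besselB μ) := by
  refine (withSeminorms_rho μ).continuous_of_isBounded (withSeminorms_rho μ) _ fun m =>
    ⟨{m + 1}, 1, fun f => ?_⟩
  rw [one_smul, Finset.sup_singleton, Seminorm.comp_apply, LinearMap.neg_apply, map_neg_eq_map]
  refine rho_le (apply_nonneg _ _) fun k hk => ?_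
  have := normY_pow_le_rho μ (Nat.succ_le_succ hk) f
  rwa [Nat.succ_eq_add_one, pow_succ, Module.End.mul_apply] at this

/-! ### Non-negativity from resolvent bounds in `Y` -/

/-- `t - S_μ` is bijective from its domain in `Y` onto `Y`, and `t (t - S_μ)⁻¹` is a contraction. -/
structure HasContractiveResolvent (μ t : ℝ) : Prop where
  eq_zero : ∀ f ∈ Y μ, IsBesselImage μ f ((t : ℂ) • f) → f = 0
  exists_solution : ∀ f : Y μ, ∃ u : Y μ, IsBesselImage μ u.1 ((t : ℂ) • u.1 - f.1) ∧
    normY μ ((t : ℂ) • u) ≤ normY μ f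

theorem HasContractiveResolvent.injective {μ t : ℝ} (h : HasContractiveResolvent μ t) :
    Function.Injective fun x : B μ => (t : ℂ) • x - besselB μ x := by
  have key : ∀ z : B μ, besselB μ z = (t : ℂ) • z → z = 0 := fun z hz => by
    have := besselB_spec z
    rw [hz, map_smul] at this
    refine B.incl_injective μ ((h.eq_zero _ (B.toY μ z).2 this).trans (map_zero _).symm)
  intro x y hxy
  have hxy : (t : ℂ) • x - besselB μ x = (t : ℂ) • y - besselB μ y := hxy
  refine sub_eq_zero.1 (key _ ?_)
  rw [map_sub, smul_sub]
  have : besselB μ x - besselB μ y - ((t : ℂ) • x - (t : ℂ) • y) =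
      -(((t : ℂ) • x - besselB μ x) - ((t : ℂ) • y - besselB μ y)) := by abel
  rw [← sub_eq_zero, this, hxy, sub_self, neg_zero]

/-- The solution `u` in `Y` lies in `B` by a bootstrap: `S_μ u = t u - f`, so `u` gains one level of
`powDomain` at each step. -/
theorem HasContractiveResolvent.surjective {μ t : ℝ} (h : HasContractiveResolvent μ t) :
    Function.Surjective fun x : B μ => (t : ℂ) • x - besselB μ x := by
  intro f
  obtain ⟨u, hu, -⟩ := h.exists_solution (B.toY μ f)
  have hf : ∀ k, (B.toY μ f).1 ∈ powDomain μ k := fun k => (Submodule.mem_iInf _).1 f.2 k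
  have hdom : ∀ k, u.1 ∈ powDomain μ k := by
    intro k
    induction k with
    | zero => exact u.2
    | succ k ih => exact ⟨u.2, _, sub_mem ((powDomain μ k).smul_mem _ ih) (hf k), hu⟩
  let b : B μ := ⟨u.1, (Submodule.mem_iInf _).2 hdom⟩
  refine ⟨b, ?_⟩
  have : besselB μ b = (t : ℂ) • b - f := besselB_eq_of_isBesselImage hu
  simp only [this, sub_sub_cancel]

/-- By uniqueness, `x` is the solution supplied for the right-hand side `t x - S_μ x`, so it
inherits the norm bound. -/
theorem HasContractiveResolvent.normY_le {μ t : ℝ} (h : HasContractiveResolvent μ t) (x : B μ) :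
    normY μ (B.toY μ ((t : ℂ) • x)) ≤ normY μ (B.toY μ ((t : ℂ) • x - besselB μ x)) := by
  obtain ⟨u, hu, hle⟩ := h.exists_solution (B.toY μ ((t : ℂ) • x - besselB μ x))
  have hd : IsBesselImage μ (u.1 - (B.toY μ x).1) ((t : ℂ) • (u.1 - (B.toY μ x).1)) := by
    have e : (t : ℂ) • (u.1 - (B.toY μ x).1) =
        ((t : ℂ) • u.1 - (B.toY μ ((t : ℂ) • x - besselB μ x)).1) -
          (B.toY μ (besselB μ x)).1 := by
      rw [map_sub, map_smul, smul_sub]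
      simp only [AddSubgroupClass.coe_sub, Submodule.coe_smul]
      abel
    rw [e]
    exact hu.sub (besselB_spec x)
  have hux : u = B.toY μ x :=
    Subtype.ext (sub_eq_zero.1 (h.eq_zero _ (sub_mem u.2 (B.toY μ x).2) hd))
  rwa [hux, ← map_smul] at hle

/-- `S_μ^k` commutes with `t - S_μ`, so the estimate in `Y` applies to `S_μ^k x`. -/
theorem HasContractiveResolvent.rho_le {μ t : ℝ} (h : HasContractiveResolvent μ t) (m : ℕ)
    (x : B μ) : rho μ m ((t : ℂ) • x) ≤ rho μ m ((t : ℂ) • x - besselB μ x) := by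
  refine Bessel.rho_le (apply_nonneg _ _) fun k hk => ?_
  refine le_trans ?_ (normY_pow_le_rho μ hk _)
  have e : (besselB μ ^ k) (besselB μ x) = besselB μ ((besselB μ ^ k) x) := by
    rw [← Module.End.mul_apply, ← pow_succ, pow_succ', Module.End.mul_apply]
  have e' : (besselB μ ^ k) ((t : ℂ) • x) = (t : ℂ) • (besselB μ ^ k) x := map_smul _ _ _
  rw [map_sub, e, e']
  exact h.normY_le _

theorem isNonnegativeOperator_of_hasContractiveResolvent {μ : ℝ}
    (h : ∀ t : ℝ, 0 < t → HasContractiveResolvent μ t) :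
    IsNonnegativeOperator ((-besselB μ).toPMap ⊤) := by
  have e : ∀ (t : ℝ) (x : ((-besselB μ).toPMap ⊤).domain),
      (t : ℂ) • (x : B μ) + (-besselB μ).toPMap ⊤ x = (t : ℂ) • (x : B μ) - besselB μ x := by
    intro t x
    rw [sub_eq_add_neg]
    rfl
  refine ⟨fun t ht => ⟨fun x y hxy => ?_, fun f => ?_⟩, fun U hU => ?_⟩
  · simp only [e] at hxy
    exact Subtype.ext ((h t ht).injective hxy)
  · obtain ⟨b, hb⟩ := (h t ht).surjective f
    exact ⟨⟨b, Submodule.mem_top⟩, (e t _).trans hb⟩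
  · obtain ⟨s, r, hr, hs⟩ := ((withSeminorms_rho μ).mem_nhds_iff 0 U).1 hU
    -- The estimate for each `ρ_m` has constant `1` for all `t`, so the ball found inside `U` serves
    -- as `V`.
    refine ⟨(s.sup (rho μ)).ball 0 r,
      ((withSeminorms_rho μ).mem_nhds_iff 0 _).2 ⟨s, r, hr, Subset.rfl⟩, fun t ht x hx => hs ?_⟩
    rw [e] at hx
    rw [Seminorm.mem_ball, sub_zero] at hx ⊢
    refine lt_of_le_of_lt (Seminorm.finset_sup_apply_le (apply_nonneg _ _) fun m hm => ?_) hx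
    exact ((h t ht).rho_le m x).trans (Seminorm.le_finset_sup_apply hm)

/-! ### The modified Bessel series -/

/-- The coefficient `1 / (n! (ν+1)(ν+2)⋯(ν+n))`. -/
noncomputable def besselCoeff (ν : ℝ) (n : ℕ) : ℝ :=
  ((n.factorial : ℝ) * ∏ i ∈ Finset.range n, (ν + 1 + i))⁻¹

/-- The entire function `∑ zⁿ / (n! (ν+1)(ν+2)⋯(ν+n))`. -/
noncomputable def besselSeries (ν z : ℝ) : ℝ := ∑' n, besselCoeff ν n * z ^ n

theorem besselCoeff_pos {ν : ℝ} (hν : -1 < ν) (n : ℕ) : 0 < besselCoeff ν n := by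
  refine inv_pos.2 (mul_pos (by positivity) (Finset.prod_pos fun i _ => ?_))
  have : (0 : ℝ) ≤ i := i.cast_nonneg
  linarith

/-- Splitting off the first factor of the product raises `ν` by one; this is the coefficient form of
the derivative formula. -/
theorem besselCoeff_succ {ν : ℝ} (hν : -1 < ν) (n : ℕ) :
    (n + 1) * besselCoeff ν (n + 1) = besselCoeff (ν + 1) n / (ν + 1) := by
  have h1 : ν + 1 ≠ 0 := by linarith
  have h2 : ∏ i ∈ Finset.range (n + 1), (ν + 1 + (i : ℝ)) =
      (∏ i ∈ Finset.range n, (ν + 1 + 1 + (i : ℝ))) * (ν + 1) := by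
    rw [Finset.prod_range_succ']
    simp only [Nat.cast_add, Nat.cast_one, Nat.cast_zero, add_zero]
    congr 1
    exact Finset.prod_congr rfl fun i _ => by ring
  have h3 : ∏ i ∈ Finset.range n, (ν + 1 + 1 + (i : ℝ)) ≠ 0 :=
    Finset.prod_ne_zero_iff.2 fun i _ => by
      have : (0 : ℝ) ≤ i := i.cast_nonneg
      linarith
  have h4 : (n.factorial : ℝ) ≠ 0 := by positivity
  rw [besselCoeff, besselCoeff, h2, Nat.factorial_succ]
  push_cast
  field_simp

theorem besselCoeff_shift {ν : ℝ} (hν : -1 < ν) (n : ℕ) :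
    (ν + 1) * besselCoeff ν n = (ν + 1 + n) * besselCoeff (ν + 1) n := by
  have h1 : ν + 1 ≠ 0 := by linarith
  have hpos : ∀ i : ℕ, ν + 1 + (i : ℝ) ≠ 0 := fun i => by
    have : (0 : ℝ) ≤ i := i.cast_nonneg
    linarith
  have h2 : (∏ i ∈ Finset.range n, (ν + 1 + (i : ℝ))) * (ν + 1 + n) =
      (∏ i ∈ Finset.range n, (ν + 1 + 1 + (i : ℝ))) * (ν + 1) := by
    rw [← Finset.prod_range_succ, Finset.prod_range_succ']
    simp only [Nat.cast_add, Nat.cast_one, Nat.cast_zero, add_zero]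
    congr 1
    exact Finset.prod_congr rfl fun i _ => by ring
  have h3 : ∏ i ∈ Finset.range n, (ν + 1 + 1 + (i : ℝ)) ≠ 0 :=
    Finset.prod_ne_zero_iff.2 fun i _ => by
      have : (0 : ℝ) ≤ i := i.cast_nonneg
      linarith
  have h3' : ∏ i ∈ Finset.range n, (ν + 1 + (i : ℝ)) ≠ 0 :=
    Finset.prod_ne_zero_iff.2 fun i _ => hpos i
  have h4 : (n.factorial : ℝ) ≠ 0 := by positivity
  rw [besselCoeff, besselCoeff]
  field_simp
  linear_combination -h2

theorem summable_besselCoeff {ν : ℝ} (hν : -1 < ν) (z : ℝ) :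
    Summable fun n => besselCoeff ν n * z ^ n := by
  -- All factors of the product after the first are at least `1`, so `m` bounds the product below
  -- and the series is dominated by that of `m⁻¹ exp |z|`.
  set m := min 1 (ν + 1)
  have hm : 0 < m := lt_min one_pos (by linarith)
  have hprod : ∀ n : ℕ, m ≤ ∏ i ∈ Finset.range n, (ν + 1 + (i : ℝ)) := by
    intro n
    cases n with
    | zero => simp [m]
    | succ n =>
      rw [Finset.prod_range_succ']
      have : (1 : ℝ) ≤ ∏ k ∈ Finset.range n, (ν + 1 + ((k + 1 : ℕ) : ℝ)) := by
        refine Finset.prod_const_one.symm.le.trans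
          (Finset.prod_le_prod (fun _ _ => zero_le_one) fun i _ => ?_)
        have : (0 : ℝ) ≤ i := i.cast_nonneg
        push_cast
        linarith
      have h1 : m ≤ ν + 1 := min_le_right _ _
      simp only [Nat.cast_zero, add_zero]
      nlinarith
  refine Summable.of_norm_bounded ((Real.summable_pow_div_factorial |z|).mul_left m⁻¹) fun n => ?_
  have hf : (0 : ℝ) < n.factorial := by positivity
  rw [norm_mul, norm_pow, Real.norm_eq_abs, Real.norm_eq_abs, abs_of_pos (besselCoeff_pos hν n),
    besselCoeff, mul_inv]
  calc (n.factorial : ℝ)⁻¹ * (∏ i ∈ Finset.range n, (ν + 1 + (i : ℝ)))⁻¹ * |z| ^ n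
      ≤ (n.factorial : ℝ)⁻¹ * m⁻¹ * |z| ^ n := by gcongr; exact hprod n
    _ = m⁻¹ * (|z| ^ n / n.factorial) := by ring

theorem hasDerivAt_besselSeries {ν : ℝ} (hν : -1 < ν) (z : ℝ) :
    HasDerivAt (besselSeries ν) (besselSeries (ν + 1) z / (ν + 1)) z := by
  have hν' : -1 < ν + 1 := by linarith
  have hshift : ∀ y : ℝ, ∀ n : ℕ, besselCoeff ν (n + 1) * (((n + 1 : ℕ) : ℝ) * y ^ n) =
      (besselCoeff (ν + 1) n * y ^ n) / (ν + 1) := fun y n => by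
    have := besselCoeff_succ hν n
    push_cast
    linear_combination y ^ n * this
  have hs : ∀ y : ℝ, Summable fun n : ℕ => besselCoeff ν n * ((n : ℝ) * y ^ (n - 1)) := fun y => by
    rw [← summable_nat_add_iff 1]
    simp only [Nat.add_sub_cancel, hshift]
    exact (summable_besselCoeff hν' y).div_const _
  -- Termwise differentiation on the ball of radius `|z| + 1`: the coefficients are positive, so the
  -- differentiated series at `|z| + 1` is a majorant.
  have h := hasDerivAt_tsum_of_isPreconnected (g := fun n y => besselCoeff ν n * y ^ n)
    (g' := fun n y => besselCoeff ν n * ((n : ℝ) * y ^ (n - 1)))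
    (t := Metric.ball (0 : ℝ) (|z| + 1)) (y₀ := 0) (y := z) (hs (|z| + 1)) Metric.isOpen_ball
    (convex_ball _ _).isPreconnected
    (fun n y _ => (hasDerivAt_pow n y).const_mul _)
    (fun n y hy => by
      have hy : |y| ≤ |z| + 1 := by simpa using (mem_ball_zero_iff.1 hy).le
      rw [norm_mul, norm_mul, norm_pow, Real.norm_eq_abs, abs_of_pos (besselCoeff_pos hν n),
        Real.norm_natCast, Real.norm_eq_abs]
      have := (besselCoeff_pos hν n).le
      gcongr)
    (by simp; positivity) (summable_besselCoeff hν 0) (by simp)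
  refine h.congr_deriv ?_
  rw [(hs z).tsum_eq_zero_add, besselSeries, ← tsum_div_const]
  simp only [Nat.add_sub_cancel, hshift]
  simp

/-- The contiguity relation, equivalent to the modified Bessel equation. -/
theorem besselSeries_contiguous {ν : ℝ} (hν : -1 < ν) (z : ℝ) :
    z * besselSeries (ν + 2) z / ((ν + 1) * (ν + 2)) + besselSeries (ν + 1) z =
      besselSeries ν z := by
  have h1 : ν + 1 ≠ 0 := by linarith
  have h2 : ν + 2 ≠ 0 := by linarith
  have hν1 : -1 < ν + 1 := by linarith
  have s2 := summable_besselCoeff (ν := ν + 2) (by linarith) z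
  have s1 := summable_besselCoeff hν1 z
  have s0 := summable_besselCoeff hν z
  -- The first series carries a factor `z`, so its term `n` matches the terms `n + 1` of the other
  -- two, whose constant terms agree.
  have e : ∀ n : ℕ, z * (besselCoeff (ν + 2) n * z ^ n) / ((ν + 1) * (ν + 2)) +
      besselCoeff (ν + 1) (n + 1) * z ^ (n + 1) = besselCoeff ν (n + 1) * z ^ (n + 1) := by
    intro n
    have a := besselCoeff_succ hν1 n
    have b := besselCoeff_shift hν (n + 1)
    rw [show ν + 1 + 1 = ν + 2 by ring, eq_div_iff h2] at a
    push_cast at b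
    field_simp
    rw [pow_succ]
    linear_combination (-z ^ n * z) * a - (ν + 2) * z ^ n * z * b
  have c0 : besselCoeff (ν + 1) 0 = besselCoeff ν 0 := by simp [besselCoeff]
  rw [besselSeries, besselSeries, besselSeries, s1.tsum_eq_zero_add, s0.tsum_eq_zero_add,
    ← tsum_mul_left, ← tsum_div_const, c0]
  rw [add_left_comm, ← Summable.tsum_add ((s2.mul_left z).div_const _)
    ((summable_nat_add_iff 1).2 s1), tsum_congr e]

theorem besselSeries_ge {ν : ℝ} (hν : -1 < ν) {z : ℝ} (hz : 0 ≤ z) (n : ℕ) :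
    besselCoeff ν n * z ^ n ≤ besselSeries ν z :=
  (summable_besselCoeff hν z).le_tsum n fun m _ =>
    mul_nonneg (besselCoeff_pos hν m).le (pow_nonneg hz m)

theorem besselSeries_pos {ν : ℝ} (hν : -1 < ν) {z : ℝ} (hz : 0 ≤ z) : 0 < besselSeries ν z :=
  lt_of_lt_of_le (by simpa using besselCoeff_pos hν 0) (besselSeries_ge hν hz 0)

theorem besselSeries_mono {ν : ℝ} (hν : -1 < ν) {y z : ℝ} (hy : 0 ≤ y) (hyz : y ≤ z) :
    besselSeries ν y ≤ besselSeries ν z :=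
  (summable_besselCoeff hν y).tsum_le_tsum (fun n => by
    have := (besselCoeff_pos hν n).le
    gcongr) (summable_besselCoeff hν z)

/-- The derivative is a multiple of the series for `ν + 1`, hence an induction over all `ν` at once.
-/
theorem contDiff_besselSeries {ν : ℝ} (hν : -1 < ν) : ContDiff ℝ ∞ (besselSeries ν) := by
  refine contDiff_infty.2 fun n => ?_
  induction n generalizing ν with
  | zero =>
    exact contDiff_zero.2
      (continuous_iff_continuousAt.2 fun z => (hasDerivAt_besselSeries hν z).continuousAt)
  | succ n ih =>
    refine (contDiff_succ_iff_deriv (n := n)).2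
      ⟨fun z => (hasDerivAt_besselSeries hν z).differentiableAt, by simp, ?_⟩
    rw [funext fun z => (hasDerivAt_besselSeries hν z).deriv]
    exact (ih (by linarith)).div_const _

/-! ### Tail integrals -/

theorem hasDerivAt_integral_Ioi {j : ℝ → ℝ} (hi : ∀ x > 0, IntegrableOn j (Ioi x))
    (hc : ContinuousOn j (Ioi 0)) {x : ℝ} (hx : 0 < x) :
    HasDerivAt (fun y => ∫ t in Ioi y, j t) (-j x) x := by
  have hx2 : 0 < x / 2 := half_pos hx
  -- The base point is `x / 2` because `j` need not be integrable near `0`.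
  have e : (fun y => ∫ t in Ioi y, j t) =ᶠ[𝓝 x]
      fun y => (∫ t in Ioi (x / 2), j t) - ∫ t in (x / 2)..y, j t := by
    filter_upwards [Ioi_mem_nhds (half_lt_self hx)] with y hy
    have hy : x / 2 < y := hy
    rw [intervalIntegral.integral_of_le hy.le, ← Ioc_union_Ioi_eq_Ioi hy.le,
      setIntegral_union Ioc_disjoint_Ioi_same measurableSet_Ioi
        ((hi _ hx2).mono_set Ioc_subset_Ioi_self) (hi y (hx2.trans hy))]
    ring
  refine HasDerivAt.congr_of_eventuallyEq ?_ e
  refine HasDerivAt.const_sub _ ?_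
  refine intervalIntegral.integral_hasDerivAt_right ?_
    (hc.stronglyMeasurableAtFilter isOpen_Ioi x hx) (hc.continuousAt (Ioi_mem_nhds hx))
  rw [intervalIntegrable_iff_integrableOn_Ioc_of_le (half_lt_self hx).le]
  exact (hi _ hx2).mono_set Ioc_subset_Ioi_self

/-! ### Two solutions of `u'' + (2μ+1) x⁻¹ u' = l u` -/

noncomputable section

/-- The solution regular at the origin, a multiple of `x^(-μ) I_μ(√l x)`. -/
def solP (μ l x : ℝ) : ℝ := besselSeries μ (l * x ^ 2 / 4)

/-- `x⁻¹ D` applied to `solP`. -/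
def solPD (μ l x : ℝ) : ℝ := l / (2 * (μ + 1)) * besselSeries (μ + 1) (l * x ^ 2 / 4)

/-- `(x⁻¹ D)²` applied to `solP`. -/
def solPDD (μ l x : ℝ) : ℝ :=
  l ^ 2 / (4 * (μ + 1) * (μ + 2)) * besselSeries (μ + 2) (l * x ^ 2 / 4)

/-- The inverse of `x^(2μ+1) p²`, for `p` the regular solution. -/
def wronskWeight (μ l x : ℝ) : ℝ := (x ^ (2 * μ + 1) * solP μ l x ^ 2)⁻¹

/-- The tail integral in the reduction of order formula. -/
def solTail (μ l x : ℝ) : ℝ := ∫ t in Ioi x, wronskWeight μ l t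

/-- The solution decaying at infinity, obtained from `solP` by reduction of order. -/
def solQ (μ l x : ℝ) : ℝ := solP μ l x * solTail μ l x

/-- `x⁻¹ D` applied to `solQ`. -/
def solQD (μ l x : ℝ) : ℝ :=
  solPD μ l x * solTail μ l x - (x * x ^ (2 * μ + 1) * solP μ l x)⁻¹

/-- `(x⁻¹ D)²` applied to `solQ`. -/
def solQDD (μ l x : ℝ) : ℝ := (l * solQ μ l x - (2 * μ + 2) * solQD μ l x) / x ^ 2

end

/-! ### Positivity, equations and growth of the two solutions -/

variable {μ l : ℝ}

theorem hasDerivAt_besselSeries_sq {ν : ℝ} (hν : -1 < ν) (l x : ℝ) :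
    HasDerivAt (fun x => besselSeries ν (l * x ^ 2 / 4))
      (x * (l / (2 * (ν + 1)) * besselSeries (ν + 1) (l * x ^ 2 / 4))) x := by
  have h1 : ν + 1 ≠ 0 := by linarith
  have h : HasDerivAt (fun x : ℝ => l * x ^ 2 / 4) (l * (2 * x) / 4) x := by
    simpa using ((hasDerivAt_pow 2 x).const_mul l).div_const 4
  refine ((hasDerivAt_besselSeries hν _).comp x h).congr_deriv ?_
  field_simp
  ring

theorem solP_pos (hμ : -1 / 2 < μ) (hl : 0 < l) (x : ℝ) : 0 < solP μ l x :=
  besselSeries_pos (by linarith) (by positivity)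

theorem solPD_pos (hμ : -1 / 2 < μ) (hl : 0 < l) (x : ℝ) : 0 < solPD μ l x := by
  have : 0 < μ + 1 := by linarith
  exact mul_pos (by positivity) (besselSeries_pos (by linarith) (by positivity))

theorem solPDD_pos (hμ : -1 / 2 < μ) (hl : 0 < l) (x : ℝ) : 0 < solPDD μ l x := by
  have h1 : 0 < μ + 1 := by linarith
  have h2 : 0 < μ + 2 := by linarith
  exact mul_pos (by positivity) (besselSeries_pos (by linarith) (by positivity))

theorem hasDerivAt_solP (hμ : -1 / 2 < μ) (l x : ℝ) :
    HasDerivAt (solP μ l) (x * solPD μ l x) x :=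
  hasDerivAt_besselSeries_sq (by linarith) l x

theorem hasDerivAt_solPD (hμ : -1 / 2 < μ) (l x : ℝ) :
    HasDerivAt (solPD μ l) (x * solPDD μ l x) x := by
  refine ((hasDerivAt_besselSeries_sq (ν := μ + 1) (by linarith) l x).const_mul
    (l / (2 * (μ + 1)))).congr_deriv ?_
  have h1 : μ + 1 ≠ 0 := by linarith
  have h2 : μ + 2 ≠ 0 := by linarith
  rw [solPDD, show μ + 1 + 1 = μ + 2 by ring]
  field_simp
  ring

theorem solP_equation (hμ : -1 / 2 < μ) (l x : ℝ) :
    x ^ 2 * solPDD μ l x + (2 * μ + 2) * solPD μ l x = l * solP μ l x := by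
  have h := besselSeries_contiguous (ν := μ) (by linarith) (l * x ^ 2 / 4)
  have h1 : μ + 1 ≠ 0 := by linarith
  have h2 : μ + 2 ≠ 0 := by linarith
  rw [solP, ← h, solPDD, solPD]
  field_simp

theorem solP_mono (hμ : -1 / 2 < μ) (hl : 0 < l) {x y : ℝ} (hx : 0 ≤ x) (hxy : x ≤ y) :
    solP μ l x ≤ solP μ l y :=
  besselSeries_mono (by linarith) (by positivity) (by gcongr)

/-- The term with `solPDD` in the equation is nonnegative and can be dropped. -/
theorem solPD_le (hμ : -1 / 2 < μ) (hl : 0 < l) (x : ℝ) :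
    solPD μ l x ≤ l / (2 * μ + 2) * solP μ l x := by
  have h := solP_equation hμ l x
  have h0 := mul_nonneg (sq_nonneg x) (solPDD_pos hμ hl x).le
  have h1 : 0 < 2 * μ + 2 := by linarith
  rw [div_mul_eq_mul_div, le_div_iff₀ h1]
  linarith

/-- A single term of the positive series bounds it below. Such polynomial bounds of every order
replace exponential asymptotics throughout. -/
theorem exists_solP_ge (hμ : -1 / 2 < μ) (hl : 0 < l) (N : ℕ) :
    ∃ c > 0, ∀ x, c * x ^ (2 * N) ≤ solP μ l x := by
  have hc := besselCoeff_pos (ν := μ) (by linarith) N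
  refine ⟨besselCoeff μ N * (l / 4) ^ N, by positivity, fun x => ?_⟩
  refine le_trans (le_of_eq ?_) (besselSeries_ge (ν := μ) (by linarith)
    (by positivity : 0 ≤ l * x ^ 2 / 4) N)
  rw [mul_assoc, pow_mul, ← mul_pow]
  congr 2
  ring

theorem continuous_solP (hμ : -1 / 2 < μ) (l : ℝ) : Continuous (solP μ l) :=
  continuous_iff_continuousAt.2 fun x => (hasDerivAt_solP hμ l x).continuousAt

theorem continuous_solPD (hμ : -1 / 2 < μ) (l : ℝ) : Continuous (solPD μ l) :=
  continuous_iff_continuousAt.2 fun x => (hasDerivAt_solPD hμ l x).continuousAt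

theorem wronskWeight_pos (hμ : -1 / 2 < μ) (hl : 0 < l) {x : ℝ} (hx : 0 < x) :
    0 < wronskWeight μ l x :=
  inv_pos.2 (mul_pos (Real.rpow_pos_of_pos hx _) (pow_pos (solP_pos hμ hl x) 2))

theorem contDiff_solP (hμ : -1 / 2 < μ) (l : ℝ) : ContDiff ℝ ∞ (solP μ l) :=
  (contDiff_besselSeries (by linarith)).comp (by fun_prop)

theorem contDiffOn_wronskWeight (hμ : -1 / 2 < μ) (hl : 0 < l) :
    ContDiffOn ℝ ∞ (wronskWeight μ l) (Ioi 0) := by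
  have h : ContDiffOn ℝ ∞ (fun x : ℝ => x ^ (2 * μ + 1)) (Ioi 0) := fun x hx =>
    (Real.contDiffAt_rpow_const_of_ne (ne_of_gt hx)).contDiffWithinAt
  refine (h.mul ((contDiff_solP hμ l).pow 2).contDiffOn).inv fun x hx => ?_
  exact (mul_pos (Real.rpow_pos_of_pos hx _) (pow_pos (solP_pos hμ hl x) 2)).ne'

theorem integrableOn_wronskWeight (hμ : -1 / 2 < μ) (hl : 0 < l) {x : ℝ} (hx : 0 < x) :
    IntegrableOn (wronskWeight μ l) (Ioi x) := by
  obtain ⟨c, hc, hcP⟩ := exists_solP_ge hμ hl 1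
  have hw := Real.rpow_pos_of_pos hx (2 * μ + 1)
  have h0 := solP_pos hμ hl 0
  -- For `t > x`, bound `t^(2μ+1)` below by `x^(2μ+1)`, one factor `p(t)` by `p(0)` and the other by
  -- `c t²`.
  have hi : IntegrableOn (fun t : ℝ => (x ^ (2 * μ + 1) * (solP μ l 0 * c))⁻¹ * t ^ (-2 : ℝ))
      (Ioi x) := (integrableOn_Ioi_rpow_of_lt (by norm_num) hx).const_mul _
  refine hi.mono' (((contDiffOn_wronskWeight hμ hl).continuousOn.mono
    (Ioi_subset_Ioi hx.le)).aestronglyMeasurable measurableSet_Ioi) ?_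
  refine (ae_restrict_iff' measurableSet_Ioi).2 (.of_forall fun t ht => ?_)
  have hxt : x < t := ht
  have ht0 : 0 < t := hx.trans hxt
  rw [Real.norm_of_nonneg (wronskWeight_pos hμ hl ht0).le, Real.rpow_neg ht0.le, ← mul_inv,
    wronskWeight]
  have a1 : x ^ (2 * μ + 1) ≤ t ^ (2 * μ + 1) :=
    Real.rpow_le_rpow hx.le hxt.le (by linarith)
  have a2 := hcP t
  have a3 := solP_mono hμ hl le_rfl ht0.le
  have e : t ^ (2 : ℝ) = t ^ 2 := by norm_cast
  rw [e]
  refine inv_anti₀ (by positivity) ?_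
  calc x ^ (2 * μ + 1) * (solP μ l 0 * c) * t ^ 2
      = x ^ (2 * μ + 1) * (solP μ l 0 * (c * t ^ (2 * 1))) := by ring
    _ ≤ t ^ (2 * μ + 1) * (solP μ l t * solP μ l t) := by
        have := (solP_pos hμ hl t).le
        gcongr
    _ = _ := by ring

theorem hasDerivAt_solTail (hμ : -1 / 2 < μ) (hl : 0 < l) {x : ℝ} (hx : 0 < x) :
    HasDerivAt (solTail μ l) (-wronskWeight μ l x) x :=
  hasDerivAt_integral_Ioi (fun _ hx => integrableOn_wronskWeight hμ hl hx)
    (contDiffOn_wronskWeight hμ hl).continuousOn hx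

theorem contDiffOn_solTail (hμ : -1 / 2 < μ) (hl : 0 < l) :
    ContDiffOn ℝ ∞ (solTail μ l) (Ioi 0) := by
  refine (contDiffOn_infty_iff_deriv_of_isOpen isOpen_Ioi).2 ⟨fun x hx =>
    (hasDerivAt_solTail hμ hl hx).differentiableAt.differentiableWithinAt, ?_⟩
  exact (contDiffOn_wronskWeight hμ hl).neg.congr fun x hx => (hasDerivAt_solTail hμ hl hx).deriv

theorem contDiffOn_solQ (hμ : -1 / 2 < μ) (hl : 0 < l) : ContDiffOn ℝ ∞ (solQ μ l) (Ioi 0) :=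
  (contDiff_solP hμ l).contDiffOn.mul (contDiffOn_solTail hμ hl)

theorem solTail_nonneg (hμ : -1 / 2 < μ) (hl : 0 < l) {x : ℝ} (hx : 0 < x) :
    0 ≤ solTail μ l x :=
  setIntegral_nonneg measurableSet_Ioi fun _ ht =>
    (wronskWeight_pos hμ hl (hx.trans ht)).le

theorem solQ_nonneg (hμ : -1 / 2 < μ) (hl : 0 < l) {x : ℝ} (hx : 0 < x) : 0 ≤ solQ μ l x :=
  mul_nonneg (solP_pos hμ hl x).le (solTail_nonneg hμ hl hx)

theorem hasDerivAt_solQ (hμ : -1 / 2 < μ) (hl : 0 < l) {x : ℝ} (hx : 0 < x) :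
    HasDerivAt (solQ μ l) (x * solQD μ l x) x := by
  refine ((hasDerivAt_solP hμ l x).mul (hasDerivAt_solTail hμ hl hx)).congr_deriv ?_
  have h1 := (Real.rpow_pos_of_pos hx (2 * μ + 1)).ne'
  have h2 := (solP_pos hμ hl x).ne'
  rw [solQD, wronskWeight]
  field_simp
  ring

/-- Since `solQDD` is defined by solving the differential equation for it, this derivative is where
`solQ` is shown to be a solution. -/
theorem hasDerivAt_solQD (hμ : -1 / 2 < μ) (hl : 0 < l) {x : ℝ} (hx : 0 < x) :
    HasDerivAt (solQD μ l) (x * solQDD μ l x) x := by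
  have h1 := (Real.rpow_pos_of_pos hx (2 * μ + 1)).ne'
  have h2 := (solP_pos hμ hl x).ne'
  have hw : HasDerivAt (fun y : ℝ => y ^ (2 * μ + 1)) (x ^ (2 * μ + 1) * ((2 * μ + 1) / x)) x := by
    refine (Real.hasDerivAt_rpow_const (Or.inl hx.ne')).congr_deriv ?_
    rw [Real.rpow_sub_one hx.ne']; ring
  refine (((hasDerivAt_solPD hμ l x).mul (hasDerivAt_solTail hμ hl hx)).sub
    ((((hasDerivAt_id x).mul hw).mul (hasDerivAt_solP hμ l x)).inv (by
      simp only [Pi.mul_apply, id]; positivity))).congr_deriv ?_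
  have he := solP_equation hμ l x
  rw [solQDD, solQ, solQD, wronskWeight]
  simp only [Pi.mul_apply, id]
  field_simp
  linear_combination (x * x ^ (2 * μ + 1) * solP μ l x ^ 2 * solTail μ l x) * he

theorem solQ_equation (μ l : ℝ) {x : ℝ} (hx : 0 < x) :
    x ^ 2 * solQDD μ l x + (2 * μ + 2) * solQD μ l x = l * solQ μ l x := by
  rw [solQDD]
  field_simp
  ring

theorem wronskian_sol (hμ : -1 / 2 < μ) (hl : 0 < l) {x : ℝ} (hx : 0 < x) :
    x * x ^ (2 * μ + 1) * (solPD μ l x * solQ μ l x - solP μ l x * solQD μ l x) = 1 := by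
  have h1 := (Real.rpow_pos_of_pos hx (2 * μ + 1)).ne'
  have h2 := (solP_pos hμ hl x).ne'
  rw [solQD, solQ]
  field_simp
  ring

/-- In `∫_x^∞ p(x) / (t^(2μ+1) p(t)²) dt` one factor `p(t)` absorbs `p(x)`. The other is at least `c
t^(2N+2)`, which absorbs `x^N` and leaves an integrable `t⁻²`. -/
theorem exists_solQ_decay (hμ : -1 / 2 < μ) (hl : 0 < l) (N : ℕ) :
    ∃ C, ∀ x, 1 ≤ x → x ^ N * solQ μ l x ≤ C := by
  obtain ⟨c, hc, hcP⟩ := exists_solP_ge hμ hl (N + 1)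
  refine ⟨c⁻¹, fun x hx => ?_⟩
  have hx0 : 0 < x := by linarith
  have hP := solP_pos hμ hl x
  have hi : IntegrableOn (fun t : ℝ => c⁻¹ * t ^ (-2 : ℝ)) (Ioi x) :=
    (integrableOn_Ioi_rpow_of_lt (by norm_num) hx0).const_mul _
  calc x ^ N * solQ μ l x = ∫ t in Ioi x, x ^ N * solP μ l x * wronskWeight μ l t := by
        rw [integral_const_mul, solQ, solTail]; ring
    _ ≤ ∫ t in Ioi x, c⁻¹ * t ^ (-2 : ℝ) := by
        refine setIntegral_mono_on ((integrableOn_wronskWeight hμ hl hx0).const_mul _) hi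
          measurableSet_Ioi fun t ht => ?_
        have hxt : x < t := ht
        have ht0 : 0 < t := hx0.trans hxt
        have hPt := solP_pos hμ hl t
        have a1 : 1 ≤ t ^ (2 * μ + 1) := Real.one_le_rpow (hx.trans hxt.le) (by linarith)
        have a2 := solP_mono hμ hl hx0.le hxt.le
        have a3 : x ^ N ≤ t ^ (2 * N) := by
          rw [pow_mul']
          calc x ^ N ≤ t ^ N := by gcongr
            _ ≤ (t ^ N) ^ 2 := le_self_pow₀ (one_le_pow₀ (hx.trans hxt.le)) two_ne_zero
        have e : t ^ (-2 : ℝ) = (t ^ 2)⁻¹ := by rw [Real.rpow_neg ht0.le]; norm_cast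
        rw [wronskWeight, e, ← mul_inv, ← div_eq_mul_inv, div_le_iff₀ (by positivity),
          inv_mul_eq_div, le_div_iff₀ (by positivity)]
        calc x ^ N * solP μ l x * (c * t ^ 2) ≤ t ^ (2 * N) * solP μ l t * (c * t ^ 2) := by
              gcongr
          _ = (c * t ^ (2 * (N + 1))) * solP μ l t := by ring
          _ ≤ solP μ l t * solP μ l t := by gcongr; exact hcP t
          _ = 1 * solP μ l t ^ 2 := by ring
          _ ≤ _ := by gcongr
    _ = c⁻¹ * x⁻¹ := by
        rw [integral_const_mul, integral_Ioi_rpow_of_lt (by norm_num) hx0]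
        norm_num
        exact Or.inl (Real.rpow_neg_one x)
    _ ≤ c⁻¹ := mul_le_of_le_one_right (inv_pos.2 hc).le (inv_le_one_of_one_le₀ hx)

theorem exists_solQD_decay (hμ : -1 / 2 < μ) (hl : 0 < l) (N : ℕ) :
    ∃ C, ∀ x, 1 ≤ x → x ^ N * |solQD μ l x| ≤ C := by
  obtain ⟨C, hC⟩ := exists_solQ_decay hμ hl N
  obtain ⟨c, hc, hcP⟩ := exists_solP_ge hμ hl N
  refine ⟨l / (2 * μ + 2) * C + c⁻¹, fun x hx => ?_⟩
  have hx0 : 0 < x := by linarith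
  have hP := solP_pos hμ hl x
  have h2 : 0 < 2 * μ + 2 := by linarith
  have a1 : 1 ≤ x ^ (2 * μ + 1) := Real.one_le_rpow hx (by linarith)
  have hT := solTail_nonneg hμ hl hx0
  have b1 : |solPD μ l x * solTail μ l x| ≤ l / (2 * μ + 2) * solQ μ l x := by
    rw [abs_of_nonneg (mul_nonneg (solPD_pos hμ hl x).le hT), solQ, ← mul_assoc]
    exact mul_le_mul_of_nonneg_right (solPD_le hμ hl x) hT
  have b2 : x ^ N * |(x * x ^ (2 * μ + 1) * solP μ l x)⁻¹| ≤ c⁻¹ := by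
    rw [abs_of_nonneg (by positivity), ← div_eq_mul_inv, div_le_iff₀ (by positivity),
      inv_mul_eq_div, le_div_iff₀ hc]
    calc x ^ N * c ≤ c * x ^ (2 * N) := by
          rw [mul_comm]
          gcongr
          omega
      _ ≤ 1 * 1 * solP μ l x := by simpa using hcP x
      _ ≤ _ := by gcongr
  calc x ^ N * |solQD μ l x|
      ≤ x ^ N * (l / (2 * μ + 2) * solQ μ l x + |(x * x ^ (2 * μ + 1) * solP μ l x)⁻¹|) := by
        gcongr
        exact (abs_sub _ _).trans (add_le_add_left b1 _)
    _ = l / (2 * μ + 2) * (x ^ N * solQ μ l x) +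
        x ^ N * |(x * x ^ (2 * μ + 1) * solP μ l x)⁻¹| := by ring
    _ ≤ _ := add_le_add (mul_le_mul_of_nonneg_left (hC x hx) (by positivity)) b2

/-! ### The Green function of `l - (D² + (2μ+1) x⁻¹ D)` -/

/-- The Green function with respect to the measure `x^(2μ+1) dx`. -/
noncomputable def greenK (μ l x y : ℝ) : ℝ := solP μ l (min x y) * solQ μ l (max x y)

theorem greenK_comm (μ l x y : ℝ) : greenK μ l x y = greenK μ l y x := by
  rw [greenK, greenK, min_comm, max_comm]

theorem greenK_nonneg (hμ : -1 / 2 < μ) (hl : 0 < l) {x y : ℝ} (hx : 0 < x) :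
    0 ≤ greenK μ l x y :=
  mul_nonneg (solP_pos hμ hl _).le (solQ_nonneg hμ hl (lt_max_of_lt_left hx))

theorem continuousOn_greenK (hμ : -1 / 2 < μ) (hl : 0 < l) :
    ContinuousOn (fun z : ℝ × ℝ => greenK μ l z.1 z.2) (Ioi 0 ×ˢ Ioi 0) := by
  refine ((continuous_solP hμ l).comp continuous_min).continuousOn.mul
    ((contDiffOn_solQ hμ hl).continuousOn.comp continuous_max.continuousOn ?_)
  rintro ⟨x, y⟩ ⟨hx, -⟩
  exact lt_max_of_lt_left (mem_Ioi.1 hx)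

theorem isRadialJet_solP (hμ : -1 / 2 < μ) (l : ℝ) :
    IsRadialJet (fun x => (solP μ l x : ℂ)) (fun x => (solPD μ l x : ℂ))
      (fun x => (solPDD μ l x : ℂ)) := fun x _ =>
  ⟨by simpa using (hasDerivAt_solP hμ l x).ofReal_comp,
    by simpa using (hasDerivAt_solPD hμ l x).ofReal_comp⟩

theorem isRadialJet_solQ (hμ : -1 / 2 < μ) (hl : 0 < l) :
    IsRadialJet (fun x => (solQ μ l x : ℂ)) (fun x => (solQD μ l x : ℂ))
      (fun x => (solQDD μ l x : ℂ)) := fun _ hx =>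
  ⟨by simpa using (hasDerivAt_solQ hμ hl hx).ofReal_comp,
    by simpa using (hasDerivAt_solQD hμ hl hx).ofReal_comp⟩

/-- Lagrange's identity. -/
theorem hasDerivAt_lagrange {a a₁ a₂ ψ ψ₁ ψ₂ : ℝ → ℂ} (ha : IsRadialJet a a₁ a₂)
    (hψ : IsRadialJet ψ ψ₁ ψ₂) {x : ℝ} (hx : 0 < x)
    (he : (x : ℂ) ^ 2 * a₂ x + (2 * μ + 2) * a₁ x = l * a x) :
    HasDerivAt (fun y : ℝ => ((y * y ^ (2 * μ + 1) : ℝ) : ℂ) * (a₁ y * ψ y - a y * ψ₁ y))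
      ((x ^ (2 * μ + 1) : ℝ) *
        (a x * (l * ψ x - ((x : ℂ) ^ 2 * ψ₂ x + (2 * μ + 2) * ψ₁ x)))) x := by
  have hx' : (x : ℂ) ≠ 0 := by exact_mod_cast hx.ne'
  have hid : HasDerivAt (fun y : ℝ => (y : ℂ)) 1 x := (hasDerivAt_id x).ofReal_comp
  have h := (hid.mul (hasDerivAt_ofReal_rpow (2 * μ + 1) hx)).mul
    (((ha x hx).2.mul (hψ x hx).1).sub ((ha x hx).1.mul (hψ x hx).2))
  refine (h.congr_deriv ?_).congr_of_eventuallyEq (.of_forall fun y => ?_)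
  · simp only [Pi.sub_apply, Pi.mul_apply]
    push_cast
    field_simp
    linear_combination ((x ^ (2 * μ + 1) : ℝ) : ℂ) * ψ x * he
  · simp

/-! ### Boundary terms and the representation formula -/

section Representation

variable {ψ ψ₁ ψ₂ : ℝ → ℂ} {C : ℝ}

theorem IsRadialJet.continuousOn (hψ : IsRadialJet ψ ψ₁ ψ₂) : ContinuousOn ψ (Ioi 0) :=
  fun x hx => (hψ x hx).1.continuousAt.continuousWithinAt

theorem IsRadialJet.continuousOn_snd (hψ : IsRadialJet ψ ψ₁ ψ₂) : ContinuousOn ψ₁ (Ioi 0) :=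
  fun x hx => (hψ x hx).2.continuousAt.continuousWithinAt

theorem integrableOn_solP_mul (hμ : -1 / 2 < μ) (hl : 0 < l) {g : ℝ → ℂ}
    (hg : ContinuousOn g (Ioi 0)) (hC : ∀ x : ℝ, 0 < x → ‖g x‖ ≤ C) {x : ℝ} (hx : 0 < x) :
    IntegrableOn (fun y : ℝ => ((y ^ (2 * μ + 1) : ℝ) : ℂ) * (solP μ l y * g y)) (Ioc 0 x) := by
  have hc : ContinuousOn (fun y : ℝ => ((y ^ (2 * μ + 1) : ℝ) : ℂ) * (solP μ l y * g y))
      (Ioc 0 x) := ((contDiffOn_ofReal_rpow _).continuousOn.mul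
    ((Complex.continuous_ofReal.comp (continuous_solP hμ l)).continuousOn.mul hg)).mono
      Ioc_subset_Ioi_self
  refine Integrable.of_bound (hc.aestronglyMeasurable measurableSet_Ioc)
    (x ^ (2 * μ + 1) * (solP μ l x * C)) ?_
  refine (ae_restrict_iff' measurableSet_Ioc).2 (.of_forall fun y hy => ?_)
  have hP := solP_pos hμ hl y
  have hw := Real.rpow_pos_of_pos hy.1 (2 * μ + 1)
  have hw' : y ^ (2 * μ + 1) ≤ x ^ (2 * μ + 1) :=
    Real.rpow_le_rpow hy.1.le hy.2 (by linarith)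
  rw [norm_mul, norm_mul, Complex.norm_real, Complex.norm_real, Real.norm_of_nonneg hw.le,
    Real.norm_of_nonneg hP.le]
  have h1 := solP_mono hμ hl hy.1.le hy.2
  have h2 := hC y hy.1
  have h3 := (solP_pos hμ hl x).le
  gcongr

theorem exists_rpow_mul_decay {f : ℝ → ℝ} (hf : ∀ N : ℕ, ∃ C, ∀ x, 1 ≤ x → x ^ N * |f x| ≤ C)
    (a : ℝ) : ∃ C, ∀ x, 1 ≤ x → x ^ a * |f x| ≤ C := by
  obtain ⟨N, hN⟩ := exists_nat_ge a
  obtain ⟨C, hC⟩ := hf N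
  refine ⟨C, fun x hx => le_trans ?_ (hC x hx)⟩
  gcongr
  rw [← Real.rpow_natCast]
  exact Real.rpow_le_rpow_of_exponent_le hx hN

theorem exists_solQ_rpow_decay (hμ : -1 / 2 < μ) (hl : 0 < l) (a : ℝ) :
    ∃ C, ∀ x, 1 ≤ x → x ^ a * |solQ μ l x| ≤ C :=
  exists_rpow_mul_decay (fun N => (exists_solQ_decay hμ hl N).imp fun C hC x hx => by
    rw [abs_of_nonneg (solQ_nonneg hμ hl (by linarith))]; exact hC x hx) a

theorem exists_solQD_rpow_decay (hμ : -1 / 2 < μ) (hl : 0 < l) (a : ℝ) :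
    ∃ C, ∀ x, 1 ≤ x → x ^ a * |solQD μ l x| ≤ C :=
  exists_rpow_mul_decay (exists_solQD_decay hμ hl) a

theorem integrableOn_solQ_mul (hμ : -1 / 2 < μ) (hl : 0 < l) {g : ℝ → ℂ}
    (hg : ContinuousOn g (Ioi 0)) (hC : ∀ x : ℝ, 0 < x → ‖g x‖ ≤ C) {x : ℝ} (hx : 0 < x) :
    IntegrableOn (fun y : ℝ => ((y ^ (2 * μ + 1) : ℝ) : ℂ) * (solQ μ l y * g y)) (Ioi x) := by
  have hc : ContinuousOn (fun y : ℝ => ((y ^ (2 * μ + 1) : ℝ) : ℂ) * (solQ μ l y * g y))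
      (Ioi 0) := (contDiffOn_ofReal_rpow _).continuousOn.mul
    ((Complex.continuous_ofReal.comp_continuousOn (contDiffOn_solQ hμ hl).continuousOn).mul hg)
  -- The decay bounds for `solQ` hold on `[1, ∞)`; continuity handles the compact piece up to `M`.
  set M := max x 1
  have hxM : x ≤ M := le_max_left _ _
  have h1M : 1 ≤ M := le_max_right _ _
  have hM : 0 < M := by linarith
  rw [← Ioc_union_Ioi_eq_Ioi hxM]
  refine IntegrableOn.union ?_ ?_
  · exact ((hc.mono fun y hy => hx.trans_le hy.1).integrableOn_Icc).mono_set Ioc_subset_Icc_self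
  · obtain ⟨D, hD⟩ := exists_solQ_rpow_decay hμ hl (2 * μ + 3)
    refine Integrable.mono' (g := fun y : ℝ => D * C * y ^ (-2 : ℝ))
      ((integrableOn_Ioi_rpow_of_lt (by norm_num) hM).const_mul _)
      ((hc.mono (Ioi_subset_Ioi hM.le)).aestronglyMeasurable measurableSet_Ioi) ?_
    refine (ae_restrict_iff' measurableSet_Ioi).2 (.of_forall fun y hy => ?_)
    have hMy : M < y := hy
    have hy0 : 0 < y := hM.trans hMy
    have hw := Real.rpow_pos_of_pos hy0 (2 * μ + 1)
    rw [norm_mul, norm_mul, Complex.norm_real, Complex.norm_real, Real.norm_of_nonneg hw.le,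
      Real.norm_eq_abs]
    have e : y ^ (2 * μ + 1) = y ^ (2 * μ + 3) * y ^ (-2 : ℝ) := by
      rw [← Real.rpow_add hy0]; ring_nf
    have h1 := hD y (h1M.trans hMy.le)
    have h2 := hC y hy0
    have h4 : 0 ≤ D := le_trans (by positivity) h1
    calc y ^ (2 * μ + 1) * (|solQ μ l y| * ‖g y‖)
        = (y ^ (2 * μ + 3) * |solQ μ l y|) * ‖g y‖ * y ^ (-2 : ℝ) := by rw [e]; ring
      _ ≤ _ := by gcongr

/-- The factor `y^(2μ+2)` tends to `0`, while `p`, `x⁻¹ p'`, `ψ` and `ψ₁` stay bounded near `0`. -/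
theorem tendsto_lagrange_zero (hμ : -1 / 2 < μ) (l : ℝ)
    (hC : ∀ x : ℝ, 0 < x → ‖ψ x‖ ≤ C) (hC₁ : ∀ x : ℝ, 0 < x → ‖ψ₁ x‖ ≤ C) :
    Tendsto (fun y : ℝ => ((y * y ^ (2 * μ + 1) : ℝ) : ℂ) *
      (solPD μ l y * ψ y - solP μ l y * ψ₁ y)) (𝓝[>] 0) (𝓝 0) := by
  have hw : Continuous fun y : ℝ => y * y ^ (2 * μ + 1) :=
    continuous_id.mul (Real.continuous_rpow_const (by linarith))
  have hb : Continuous fun y : ℝ => |y * y ^ (2 * μ + 1)| *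
      (|solPD μ l y| * C + |solP μ l y| * C) :=
    hw.abs.mul (((continuous_solPD hμ l).abs.mul continuous_const).add
      ((continuous_solP hμ l).abs.mul continuous_const))
  have ht := (hb.tendsto 0).mono_left (nhdsWithin_le_nhds (s := Ioi 0))
  simp only [zero_mul, abs_zero] at ht
  refine squeeze_zero_norm' ?_ ht
  filter_upwards [self_mem_nhdsWithin] with y hy
  rw [norm_mul, Complex.norm_real, Real.norm_eq_abs]
  refine mul_le_mul_of_nonneg_left ((norm_sub_le _ _).trans ?_) (abs_nonneg _)
  rw [norm_mul, norm_mul, Complex.norm_real, Complex.norm_real, Real.norm_eq_abs,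
    Real.norm_eq_abs]
  have h1 := hC y hy
  have h2 := hC₁ y hy
  gcongr

/-- Decay of `solQ` and `solQD` of order `y^(-2μ-3)` beats the factor `y^(2μ+2)` by `y⁻¹`. -/
theorem tendsto_lagrange_atTop (hμ : -1 / 2 < μ) (hl : 0 < l)
    (hC : ∀ x : ℝ, 0 < x → ‖ψ x‖ ≤ C) (hC₁ : ∀ x : ℝ, 0 < x → ‖ψ₁ x‖ ≤ C) :
    Tendsto (fun y : ℝ => ((y * y ^ (2 * μ + 1) : ℝ) : ℂ) *
      (solQD μ l y * ψ y - solQ μ l y * ψ₁ y)) atTop (𝓝 0) := by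
  obtain ⟨D, hD⟩ := exists_solQ_rpow_decay hμ hl (2 * μ + 3)
  obtain ⟨D', hD'⟩ := exists_solQD_rpow_decay hμ hl (2 * μ + 3)
  have ht : Tendsto (fun y : ℝ => (D' * C + D * C) * y⁻¹) atTop (𝓝 0) := by
    simpa using tendsto_inv_atTop_zero.const_mul (D' * C + D * C)
  refine squeeze_zero_norm' ?_ ht
  filter_upwards [eventually_ge_atTop 1] with y hy
  have hy0 : 0 < y := by linarith
  have hw := Real.rpow_pos_of_pos hy0 (2 * μ + 3)
  have e : y * y ^ (2 * μ + 1) = y⁻¹ * y ^ (2 * μ + 3) := by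
    rw [show 2 * μ + 3 = (2 * μ + 1) + (2 : ℕ) by push_cast; ring, Real.rpow_add_natCast hy0.ne']
    field_simp
  rw [norm_mul, Complex.norm_real, Real.norm_of_nonneg (by positivity), e]
  have h1 := hC y hy0
  have h2 := hC₁ y hy0
  have hC0 : 0 ≤ C := (norm_nonneg _).trans h1
  calc y⁻¹ * y ^ (2 * μ + 3) * ‖(solQD μ l y : ℂ) * ψ y - solQ μ l y * ψ₁ y‖
      ≤ y⁻¹ * y ^ (2 * μ + 3) * (|solQD μ l y| * C + |solQ μ l y| * C) := by
        refine mul_le_mul_of_nonneg_left ((norm_sub_le _ _).trans ?_) (by positivity)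
        rw [norm_mul, norm_mul, Complex.norm_real, Complex.norm_real, Real.norm_eq_abs,
          Real.norm_eq_abs]
        gcongr
    _ = (y ^ (2 * μ + 3) * |solQD μ l y| * C + y ^ (2 * μ + 3) * |solQ μ l y| * C) * y⁻¹ := by
        ring
    _ ≤ _ := by
        have h3 := hD y hy
        have h4 := hD' y hy
        gcongr

/-- Representation of a bounded function by means of the Green function. -/
theorem greenK_representation (hμ : -1 / 2 < μ) (hl : 0 < l) (hψ : IsRadialJet ψ ψ₁ ψ₂)
    (hc : ContinuousOn ψ₂ (Ioi 0))
    (hC : ∀ x : ℝ, 0 < x → ‖ψ x‖ ≤ C ∧ ‖ψ₁ x‖ ≤ C ∧ ‖(x : ℂ) ^ 2 * ψ₂ x‖ ≤ C)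
    {x : ℝ} (hx : 0 < x) :
    IntegrableOn (fun y : ℝ => ((y ^ (2 * μ + 1) * greenK μ l x y : ℝ) : ℂ) *
      (l * ψ y - ((y : ℂ) ^ 2 * ψ₂ y + (2 * μ + 2) * ψ₁ y))) (Ioi 0) ∧
    ∫ y in Ioi 0, ((y ^ (2 * μ + 1) * greenK μ l x y : ℝ) : ℂ) *
      (l * ψ y - ((y : ℂ) ^ 2 * ψ₂ y + (2 * μ + 2) * ψ₁ y)) = ψ x := by
  set g : ℝ → ℂ := fun y => l * ψ y - ((y : ℂ) ^ 2 * ψ₂ y + (2 * μ + 2) * ψ₁ y) with hgdef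
  have hg : ContinuousOn g (Ioi 0) := (continuousOn_const.mul hψ.continuousOn).sub
    (((Complex.continuous_ofReal.pow 2).continuousOn.mul hc).add
      (continuousOn_const.mul hψ.continuousOn_snd))
  have hgC : ∀ y : ℝ, 0 < y → ‖g y‖ ≤ ‖(l : ℂ)‖ * C + (C + ‖(2 * μ + 2 : ℂ)‖ * C) := by
    intro y hy
    obtain ⟨h1, h2, h3⟩ := hC y hy
    refine (norm_sub_le _ _).trans (add_le_add ?_ ((norm_add_le _ _).trans (add_le_add h3 ?_)))
    · rw [norm_mul]; gcongr
    · rw [norm_mul]; gcongr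
  have iP := integrableOn_solP_mul hμ hl hg hgC hx
  have iQ := integrableOn_solQ_mul hμ hl hg hgC hx
  -- Lagrange's identity is integrated with `p` on `(0, x]` and below with `q` on `(x, ∞)`; only the
  -- boundary terms at `x` survive.
  have vP : ∫ y in Ioc 0 x, ((y ^ (2 * μ + 1) : ℝ) : ℂ) * (solP μ l y * g y) =
      ((x * x ^ (2 * μ + 1) : ℝ) : ℂ) * (solPD μ l x * ψ x - solP μ l x * ψ₁ x) := by
    have hd : ∀ y : ℝ, 0 < y → HasDerivAt _ _ y := fun y hy =>
      hasDerivAt_lagrange (μ := μ) (l := l) (isRadialJet_solP hμ l) hψ hy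
        (by exact_mod_cast solP_equation hμ l y)
    rw [← intervalIntegral.integral_of_le hx.le,
      intervalIntegral.integral_eq_sub_of_hasDerivAt_of_tendsto hx (fun y hy => hd y hy.1)
        ((intervalIntegrable_iff_integrableOn_Ioc_of_le hx.le).2 iP)
        (tendsto_lagrange_zero hμ l (fun y hy => (hC y hy).1) fun y hy => (hC y hy).2.1)
        ((hd x hx).continuousAt.tendsto.mono_left nhdsWithin_le_nhds), sub_zero]
  have vQ : ∫ y in Ioi x, ((y ^ (2 * μ + 1) : ℝ) : ℂ) * (solQ μ l y * g y) =
      -(((x * x ^ (2 * μ + 1) : ℝ) : ℂ) * (solQD μ l x * ψ x - solQ μ l x * ψ₁ x)) := by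
    have hd : ∀ y : ℝ, 0 < y → HasDerivAt _ _ y := fun y hy =>
      hasDerivAt_lagrange (μ := μ) (l := l) (isRadialJet_solQ hμ hl) hψ hy
        (by exact_mod_cast solQ_equation μ l hy)
    rw [integral_Ioi_of_hasDerivAt_of_tendsto (hd x hx).continuousAt.continuousWithinAt
      (fun y hy => hd y (hx.trans hy)) iQ
      (tendsto_lagrange_atTop hμ hl (fun y hy => (hC y hy).1) fun y hy => (hC y hy).2.1), zero_sub]
  have eP : EqOn (fun y : ℝ => (solQ μ l x : ℂ) * (((y ^ (2 * μ + 1) : ℝ) : ℂ) *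
      (solP μ l y * g y))) (fun y : ℝ => ((y ^ (2 * μ + 1) * greenK μ l x y : ℝ) : ℂ) * g y)
      (Ioc 0 x) := fun y hy => by
    simp only [greenK, min_eq_right hy.2, max_eq_left hy.2]
    push_cast
    ring
  have eQ : EqOn (fun y : ℝ => (solP μ l x : ℂ) * (((y ^ (2 * μ + 1) : ℝ) : ℂ) *
      (solQ μ l y * g y))) (fun y : ℝ => ((y ^ (2 * μ + 1) * greenK μ l x y : ℝ) : ℂ) * g y)
      (Ioi x) := fun y hy => by
    simp only [greenK, min_eq_left (mem_Ioi.1 hy).le, max_eq_right (mem_Ioi.1 hy).le]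
    push_cast
    ring
  have jP := IntegrableOn.congr_fun (iP.const_mul (solQ μ l x : ℂ)) eP measurableSet_Ioc
  have jQ := IntegrableOn.congr_fun (iQ.const_mul (solP μ l x : ℂ)) eQ measurableSet_Ioi
  rw [← Ioc_union_Ioi_eq_Ioi hx.le]
  refine ⟨jP.union jQ, ?_⟩
  rw [setIntegral_union Ioc_disjoint_Ioi_same measurableSet_Ioi jP jQ,
    ← setIntegral_congr_fun measurableSet_Ioc eP, ← setIntegral_congr_fun measurableSet_Ioi eQ,
    integral_const_mul, integral_const_mul, vP, vQ]
  -- In the combined boundary terms those with `ψ₁` cancel, and the coefficient of `ψ x` is the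
  -- normalised Wronskian.
  have hW : ((x * x ^ (2 * μ + 1) : ℝ) : ℂ) *
      (solPD μ l x * solQ μ l x - solP μ l x * solQD μ l x) = 1 := by
    exact_mod_cast wronskian_sol hμ hl hx
  linear_combination ψ x * hW

/-- The representation formula for the constant `l⁻¹`, to which `l - L` assigns the value `1`. -/
theorem integral_greenK (hμ : -1 / 2 < μ) (hl : 0 < l) {x : ℝ} (hx : 0 < x) :
    IntegrableOn (fun y : ℝ => y ^ (2 * μ + 1) * greenK μ l x y) (Ioi 0) ∧
    ∫ y in Ioi 0, y ^ (2 * μ + 1) * greenK μ l x y = l⁻¹ := by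
  have hj : IsRadialJet (fun _ => ((l⁻¹ : ℝ) : ℂ)) (fun _ => 0) (fun _ => 0) := fun x _ => by
    simp only [mul_zero]
    exact ⟨hasDerivAt_const _ _, hasDerivAt_const _ _⟩
  obtain ⟨h1, h2⟩ := greenK_representation hμ hl hj continuousOn_const (C := l⁻¹)
    (fun x _ => by simp [abs_of_pos hl, hl.le]) hx
  have e : ∀ y : ℝ, ((y ^ (2 * μ + 1) * greenK μ l x y : ℝ) : ℂ) *
      (l * ((l⁻¹ : ℝ) : ℂ) - ((y : ℂ) ^ 2 * 0 + (2 * μ + 2) * 0)) =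
      ((y ^ (2 * μ + 1) * greenK μ l x y : ℝ) : ℂ) := fun y => by
    have : (l : ℂ) * ((l⁻¹ : ℝ) : ℂ) = 1 := by
      rw [← Complex.ofReal_mul, mul_inv_cancel₀ hl.ne', Complex.ofReal_one]
    rw [this]; ring
  simp only [e] at h1 h2
  refine ⟨by simpa [IntegrableOn] using h1.re, ?_⟩
  exact Complex.ofReal_injective ((integral_complex_ofReal
    (f := fun y : ℝ => y ^ (2 * μ + 1) * greenK μ l x y)).symm.trans h2)

end Representation

/-! ### Solution of `l u - S_μ u = f` in `Y` -/

/-- The kernel of `(l - S_μ)⁻¹`. -/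
noncomputable def resolventKernel (μ l x y : ℝ) : ℝ :=
  x ^ (μ + 1 / 2) * y ^ (μ + 1 / 2) * greenK μ l x y

theorem resolventKernel_comm (μ l x y : ℝ) :
    resolventKernel μ l x y = resolventKernel μ l y x := by
  rw [resolventKernel, resolventKernel, greenK_comm, mul_comm (x ^ _)]

theorem resolventKernel_nonneg (hμ : -1 / 2 < μ) (hl : 0 < l) {x y : ℝ} (hx : 0 < x) (hy : 0 < y) :
    0 ≤ resolventKernel μ l x y :=
  mul_nonneg (by positivity) (greenK_nonneg hμ hl hx)

theorem aestronglyMeasurable_resolventKernel (hμ : -1 / 2 < μ) (hl : 0 < l) :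
    AEStronglyMeasurable (fun z : ℝ × ℝ => resolventKernel μ l z.1 z.2)
      (halfLine.prod halfLine) := by
  rw [Measure.prod_restrict]
  have h : ContinuousOn (fun x : ℝ => x ^ (μ + 1 / 2)) (Ioi 0) := fun x hx =>
    (Real.continuousAt_rpow_const x _ (Or.inl (ne_of_gt hx))).continuousWithinAt
  refine ContinuousOn.aestronglyMeasurable ?_ (measurableSet_Ioi.prod measurableSet_Ioi)
  exact ((h.comp continuousOn_fst fun z hz => hz.1).mul
    (h.comp continuousOn_snd fun z hz => hz.2)).mul (continuousOn_greenK hμ hl)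

/-- The Schur identity behind both norm bounds: `x^(μ+1/2)` is an eigenfunction of the kernel with
eigenvalue `l⁻¹`. -/
theorem integral_resolventKernel (hμ : -1 / 2 < μ) (hl : 0 < l) {x : ℝ} (hx : 0 < x) :
    Integrable (fun y => resolventKernel μ l x y * y ^ (μ + 1 / 2)) halfLine ∧
    ∫ y, resolventKernel μ l x y * y ^ (μ + 1 / 2) ∂halfLine = x ^ (μ + 1 / 2) * l⁻¹ := by
  obtain ⟨h1, h2⟩ := integral_greenK hμ hl hx
  have e : EqOn (fun y => x ^ (μ + 1 / 2) * (y ^ (2 * μ + 1) * greenK μ l x y))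
      (fun y => resolventKernel μ l x y * y ^ (μ + 1 / 2)) (Ioi 0) := fun y hy => by
    simp only [resolventKernel, ← rpow_mul_rpow_half μ hy]
    ring
  refine ⟨IntegrableOn.congr_fun (h1.const_mul _) e measurableSet_Ioi, ?_⟩
  rw [← setIntegral_congr_fun measurableSet_Ioi e, integral_const_mul, h2]

theorem integral_resolventKernel_mul (hμ : -1 / 2 < μ) (hl : 0 < l) {φ : ℝ → ℂ} (hφ : MemH μ φ)
    {x : ℝ} (hx : 0 < x) :
    ∫ y, (resolventKernel μ l x y : ℂ) * (l * φ y - besselDiff μ φ y) ∂halfLine = φ x := by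
  obtain ⟨ψ, ψ₁, ψ₂, hj, hc, ⟨C, hC⟩, h⟩ := hφ.exists_isRadialJet
  have h2 := (greenK_representation hμ hl hj hc hC hx).2
  have e : EqOn (fun y => ((x ^ (μ + 1 / 2) : ℝ) : ℂ) *
      (((y ^ (2 * μ + 1) * greenK μ l x y : ℝ) : ℂ) *
        (l * ψ y - ((y : ℂ) ^ 2 * ψ₂ y + (2 * μ + 2) * ψ₁ y))))
      (fun y => (resolventKernel μ l x y : ℂ) * (l * φ y - besselDiff μ φ y)) (Ioi 0) := by
    intro y hy
    simp only [resolventKernel, ← rpow_mul_rpow_half μ hy]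
    rw [h y hy, besselDiff_of_isRadialJet hj h hy]
    push_cast
    ring
  rw [← setIntegral_congr_fun measurableSet_Ioi e, integral_const_mul, h2, h x hx]

/-- `(l - S_μ)⁻¹ f`. -/
noncomputable def resolventFun (μ l : ℝ) (f : ℝ → ℂ) (x : ℝ) : ℂ :=
  ∫ y, (resolventKernel μ l x y : ℂ) * f y ∂halfLine

/-! ### Schur bounds and the weak equation for the Green potential -/

section Solution

variable {f : ℝ → ℂ}

/-- Integrating first in `x`, symmetry of the kernel and the Schur identity leave `l⁻¹ y^(μ+1/2) ‖f
y‖`. This justifies Fubini both in the `L^1` bound and in the weak equation. -/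
theorem integrable_resolventKernel_prod (hμ : -1 / 2 < μ) (hl : 0 < l)
    (hf : AEStronglyMeasurable f halfLine)
    (hi : Integrable (fun x => ((x ^ (μ + 1 / 2) : ℝ) : ℂ) * f x) halfLine) :
    Integrable (fun z : ℝ × ℝ => resolventKernel μ l z.1 z.2 * z.1 ^ (μ + 1 / 2) * ‖f z.2‖)
      (halfLine.prod halfLine) := by
  have hm : AEStronglyMeasurable
      (fun z : ℝ × ℝ => resolventKernel μ l z.1 z.2 * z.1 ^ (μ + 1 / 2) * ‖f z.2‖)
      (halfLine.prod halfLine) := by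
    refine ((aestronglyMeasurable_resolventKernel hμ hl).mul ?_).mul hf.norm.comp_snd
    exact ((measurable_id.pow_const (μ + 1 / 2)).comp measurable_fst).aestronglyMeasurable
  refine (integrable_prod_iff' hm).2 ⟨?_, ?_⟩
  · filter_upwards [ae_halfLine_pos] with y hy
    simp only [resolventKernel_comm μ l _ y]
    exact (integral_resolventKernel hμ hl hy).1.mul_const _
  · refine (hi.norm.const_mul l⁻¹).congr ?_
    filter_upwards [ae_halfLine_pos] with y hy
    have h1 := Real.rpow_pos_of_pos hy (μ + 1 / 2)
    have : ∫ x, ‖resolventKernel μ l x y * x ^ (μ + 1 / 2) * ‖f y‖‖ ∂halfLine =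
        ∫ x, resolventKernel μ l y x * x ^ (μ + 1 / 2) * ‖f y‖ ∂halfLine := by
      refine integral_congr_ae ?_
      filter_upwards [ae_halfLine_pos] with x hx
      have h3 := resolventKernel_nonneg hμ hl hx hy
      rw [Real.norm_of_nonneg (by positivity), resolventKernel_comm]
    rw [this, integral_mul_const, (integral_resolventKernel hμ hl hy).2, norm_mul,
      Complex.norm_real, Real.norm_of_nonneg h1.le]
    ring

theorem aestronglyMeasurable_resolventFun (hμ : -1 / 2 < μ) (hl : 0 < l)
    (hf : AEStronglyMeasurable f halfLine) :
    AEStronglyMeasurable (resolventFun μ l f) halfLine :=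
  AEStronglyMeasurable.integral_prod_right'
    (f := fun z : ℝ × ℝ => (resolventKernel μ l z.1 z.2 : ℂ) * f z.2)
    ((Complex.continuous_ofReal.comp_aestronglyMeasurable
      (aestronglyMeasurable_resolventKernel hμ hl)).mul hf.comp_snd)

theorem norm_resolventFun_le (hμ : -1 / 2 < μ) (hl : 0 < l) {x : ℝ} (hx : 0 < x) :
    ‖resolventFun μ l f x‖ ≤ ∫ y, resolventKernel μ l x y * ‖f y‖ ∂halfLine := by
  refine (norm_integral_le_integral_norm _).trans (le_of_eq (integral_congr_ae ?_))
  filter_upwards [ae_halfLine_pos] with y hy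
  rw [norm_mul, Complex.norm_real, Real.norm_of_nonneg (resolventKernel_nonneg hμ hl hx hy)]

theorem norm_resolventFun_le_of_bound (hμ : -1 / 2 < μ) (hl : 0 < l) {M : ℝ}
    (hM : ∀ᵐ x ∂halfLine, ‖f x‖ ≤ M * x ^ (μ + 1 / 2)) {x : ℝ} (hx : 0 < x) :
    ‖resolventFun μ l f x‖ ≤ M * (x ^ (μ + 1 / 2) * l⁻¹) := by
  obtain ⟨h1, h2⟩ := integral_resolventKernel hμ hl hx
  refine (norm_resolventFun_le hμ hl hx).trans ?_
  rw [← h2, ← integral_const_mul]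
  refine integral_mono_of_nonneg ?_ (h1.const_mul M) ?_
  · filter_upwards [ae_halfLine_pos] with y hy
    exact mul_nonneg (resolventKernel_nonneg hμ hl hx hy) (norm_nonneg _)
  · filter_upwards [ae_halfLine_pos, hM] with y hy hMy
    have := resolventKernel_nonneg hμ hl hx hy
    calc resolventKernel μ l x y * ‖f y‖ ≤ resolventKernel μ l x y * (M * y ^ (μ + 1 / 2)) := by
          gcongr
      _ = _ := by ring

theorem integral_resolventFun_le (hμ : -1 / 2 < μ) (hl : 0 < l)
    (hf : AEStronglyMeasurable f halfLine)
    (hi : Integrable (fun x => ((x ^ (μ + 1 / 2) : ℝ) : ℂ) * f x) halfLine) :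
    Integrable (fun x => ((x ^ (μ + 1 / 2) : ℝ) : ℂ) * resolventFun μ l f x) halfLine ∧
    ∫ x, ‖((x ^ (μ + 1 / 2) : ℝ) : ℂ) * resolventFun μ l f x‖ ∂halfLine ≤
      l⁻¹ * ∫ x, ‖((x ^ (μ + 1 / 2) : ℝ) : ℂ) * f x‖ ∂halfLine := by
  have hG := integrable_resolventKernel_prod hμ hl hf hi
  have hGl := hG.integral_prod_left
  have hm : AEStronglyMeasurable
      (fun x => ((x ^ (μ + 1 / 2) : ℝ) : ℂ) * resolventFun μ l f x) halfLine :=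
    ((contDiffOn_ofReal_rpow _).continuousOn.aestronglyMeasurable measurableSet_Ioi).mul
      (aestronglyMeasurable_resolventFun hμ hl hf)
  have hle : ∀ᵐ x ∂halfLine, ‖((x ^ (μ + 1 / 2) : ℝ) : ℂ) * resolventFun μ l f x‖ ≤
      ∫ y, resolventKernel μ l x y * x ^ (μ + 1 / 2) * ‖f y‖ ∂halfLine := by
    filter_upwards [ae_halfLine_pos] with x hx
    have h1 := Real.rpow_pos_of_pos hx (μ + 1 / 2)
    rw [norm_mul, Complex.norm_real, Real.norm_of_nonneg h1.le]
    refine (mul_le_mul_of_nonneg_left (norm_resolventFun_le hμ hl hx) h1.le).trans (le_of_eq ?_)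
    rw [← integral_const_mul]
    congr 1
    ext y
    ring
  have hint := hGl.mono' hm hle
  refine ⟨hint, (integral_mono_ae hint.norm hGl hle).trans (le_of_eq ?_)⟩
  rw [integral_integral_swap (f := fun x y =>
    resolventKernel μ l x y * x ^ (μ + 1 / 2) * ‖f y‖) hG, ← integral_const_mul]
  refine integral_congr_ae ?_
  filter_upwards [ae_halfLine_pos] with y hy
  have h1 := Real.rpow_pos_of_pos hy (μ + 1 / 2)
  simp only [resolventKernel_comm μ l _ y]
  rw [integral_mul_const, (integral_resolventKernel hμ hl hy).2, norm_mul, Complex.norm_real,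
    Real.norm_of_nonneg h1.le]
  ring

/-- The weak form of `l u - S_μ u = f`: Fubini moves the symmetric kernel onto `l φ - S_μ φ`, where
the representation formula returns `φ`. -/
theorem integral_resolventFun_mul (hμ : -1 / 2 < μ) (hl : 0 < l)
    (hf : AEStronglyMeasurable f halfLine)
    (hi : Integrable (fun x => ((x ^ (μ + 1 / 2) : ℝ) : ℂ) * f x) halfLine)
    {φ : ℝ → ℂ} (hφ : MemH μ φ) :
    ∫ x, resolventFun μ l f x * (l * φ x - besselDiff μ φ x) ∂halfLine =
      ∫ x, f x * φ x ∂halfLine := by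
  set χ : ℝ → ℂ := fun x => l * φ x - besselDiff μ φ x
  have hχc : ContinuousOn χ (Ioi 0) :=
    (continuousOn_const.mul hφ.continuousOn).sub hφ.continuousOn_besselDiff
  obtain ⟨C₁, hC₁⟩ := hφ.exists_bound
  obtain ⟨C₂, hC₂⟩ := hφ.exists_bound_besselDiff
  have hχ : ∀ x : ℝ, 0 < x → ‖χ x‖ ≤ (‖(l : ℂ)‖ * C₁ + C₂) * x ^ (μ + 1 / 2) := fun x hx => by
    refine (norm_sub_le _ _).trans ?_
    rw [norm_mul, add_mul, mul_assoc]
    gcongr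
    · exact hC₁ x hx
    · exact hC₂ x hx
  have hG := integrable_resolventKernel_prod hμ hl hf hi
  have hH : Integrable (fun z : ℝ × ℝ => (resolventKernel μ l z.1 z.2 : ℂ) * f z.2 * χ z.1)
      (halfLine.prod halfLine) := by
    refine (hG.const_mul (‖(l : ℂ)‖ * C₁ + C₂)).mono' ?_ ?_
    · exact ((Complex.continuous_ofReal.comp_aestronglyMeasurable
        (aestronglyMeasurable_resolventKernel hμ hl)).mul hf.comp_snd).mul
        (hχc.aestronglyMeasurable measurableSet_Ioi).comp_fst
    · rw [Measure.prod_restrict]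
      refine (ae_restrict_iff' (measurableSet_Ioi.prod measurableSet_Ioi)).2 (.of_forall ?_)
      rintro ⟨x, y⟩ ⟨hx, hy⟩
      have h1 := resolventKernel_nonneg hμ hl hx hy
      rw [norm_mul, norm_mul, Complex.norm_real, Real.norm_of_nonneg h1]
      calc resolventKernel μ l x y * ‖f y‖ * ‖χ x‖
          ≤ resolventKernel μ l x y * ‖f y‖ * ((‖(l : ℂ)‖ * C₁ + C₂) * x ^ (μ + 1 / 2)) := by
            gcongr
            exact hχ x hx
        _ = _ := by ring
  have e1 : ∀ x, resolventFun μ l f x * χ x =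
      ∫ y, (resolventKernel μ l x y : ℂ) * f y * χ x ∂halfLine := fun x => by
    rw [integral_mul_const, resolventFun]
  refine (integral_congr_ae (.of_forall e1)).trans ?_
  rw [integral_integral_swap (f := fun x y => (resolventKernel μ l x y : ℂ) * f y * χ x) hH]
  refine integral_congr_ae ?_
  filter_upwards [ae_halfLine_pos] with y hy
  rw [← integral_resolventKernel_mul hμ hl hφ hy, ← integral_const_mul]
  congr 1
  ext x
  rw [resolventKernel_comm]
  ring

end Solution

theorem norm_le_of_mem_Y {μ : ℝ} (f : Y μ) :
    ∀ᵐ x ∂halfLine, ‖f.1 x‖ ≤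
      (eLpNorm (fun x => (rWeight μ x : ℂ) * f.1 x) ⊤ halfLine).toReal * x ^ (μ + 1 / 2) := by
  have hm : MemLp (fun x => (rWeight μ x : ℂ) * f.1 x) ⊤ halfLine := f.2.2
  have h := ae_le_eLpNormEssSup (f := fun x => (rWeight μ x : ℂ) * f.1 x) (μ := halfLine)
  filter_upwards [h, ae_halfLine_pos] with x hx hx0
  have h1 := Real.rpow_pos_of_pos hx0 (μ + 1 / 2)
  have h2 := rWeight_pos μ hx0
  rw [← eLpNorm_exponent_top] at hx
  have h3 := ENNReal.toReal_mono hm.2.ne hx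
  rw [toReal_enorm, norm_mul, Complex.norm_real, Real.norm_of_nonneg h2.le] at h3
  calc ‖f.1 x‖ = rWeight μ x * ‖f.1 x‖ * x ^ (μ + 1 / 2) := by
        linear_combination -‖f.1 x‖ * rWeight_mul_rpow μ hx0
    _ ≤ _ := by gcongr

theorem exists_solution_Y (hμ : -1 / 2 < μ) (hl : 0 < l) (f : Y μ) :
    ∃ u : Y μ, IsBesselImage μ u.1 ((l : ℂ) • u.1 - f.1) ∧
      normY μ ((l : ℂ) • u) ≤ normY μ f := by
  have hf := f.1.aestronglyMeasurable
  have hi := integrable_rpow_mul_of_mem_Y hμ f.2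
  have hc := cConst_pos hμ
  have hum := aestronglyMeasurable_resolventFun hμ hl hf
  set u := AEEqFun.mk _ hum
  have hu : u =ᵐ[halfLine] resolventFun μ l f.1 := AEEqFun.coeFn_mk _ hum
  obtain ⟨ui, ule⟩ := integral_resolventFun_le hμ hl hf hi
  have hrc : AEStronglyMeasurable (fun x => (rWeight μ x : ℂ) * u x) halfLine :=
    ((contDiffOn_rWeight μ).continuousOn.aestronglyMeasurable measurableSet_Ioi).mul
      u.aestronglyMeasurable
  set M := (eLpNorm (fun x => (rWeight μ x : ℂ) * f.1 x) ⊤ halfLine).toReal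
  have hM0 : 0 ≤ M := ENNReal.toReal_nonneg
  have hbound : ∀ᵐ x ∂halfLine, ‖(rWeight μ x : ℂ) * u x‖ ≤ M * l⁻¹ := by
    filter_upwards [hu, ae_halfLine_pos] with x hx hx0
    have h2 := rWeight_pos μ hx0
    rw [hx, norm_mul, Complex.norm_real, Real.norm_of_nonneg h2.le]
    calc rWeight μ x * ‖resolventFun μ l f.1 x‖
        ≤ rWeight μ x * (M * (x ^ (μ + 1 / 2) * l⁻¹)) := by
          gcongr
          exact norm_resolventFun_le_of_bound hμ hl (norm_le_of_mem_Y f) hx0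
      _ = M * l⁻¹ := by linear_combination M * l⁻¹ * rWeight_mul_rpow μ hx0
  have es : ∀ (g : ℝ → ℂ), (fun x => ((sWeight μ x * rWeight μ x : ℝ) : ℂ) * g x) =ᵐ[halfLine]
      fun x => (((cConst μ)⁻¹ : ℝ) : ℂ) * (((x ^ (μ + 1 / 2) : ℝ) : ℂ) * g x) := fun g => by
    filter_upwards [ae_halfLine_pos] with x hx
    rw [sWeight_mul_rWeight μ hx]
    push_cast
    ring
  have eu : (fun x => ((sWeight μ x * rWeight μ x : ℝ) : ℂ) * u x) =ᵐ[halfLine]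
      fun x => (((cConst μ)⁻¹ : ℝ) : ℂ) * (((x ^ (μ + 1 / 2) : ℝ) : ℂ) *
        resolventFun μ l f.1 x) := by
    refine (es u).trans ?_
    filter_upwards [hu] with x hx
    rw [hx]
  have m1 : MemLp (fun x => ((sWeight μ x * rWeight μ x : ℝ) : ℂ) * u x) 1 halfLine :=
    (memLp_congr_ae eu).2 (memLp_one_iff_integrable.2 (ui.const_mul _))
  have m2 : MemLp (fun x => (rWeight μ x : ℂ) * u x) ⊤ halfLine :=
    memLp_top_of_bound hrc _ hbound
  have hL1 : ∀ {g : ℝ → ℂ}, AEStronglyMeasurable g halfLine →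
      (eLpNorm g 1 halfLine).toReal = ∫ x, ‖g x‖ ∂halfLine := fun {g} hg => by
    rw [eLpNorm_one_eq_lintegral_enorm, integral_norm_eq_lintegral_enorm hg]
  have n1 : (eLpNorm (fun x => ((sWeight μ x * rWeight μ x : ℝ) : ℂ) * u x) 1 halfLine).toReal ≤
      l⁻¹ * (eLpNorm (fun x => ((sWeight μ x * rWeight μ x : ℝ) : ℂ) * f.1 x) 1
        halfLine).toReal := by
    rw [eLpNorm_congr_ae eu, eLpNorm_congr_ae (es f.1), hL1 (ui.const_mul _).1,
      hL1 (hi.const_mul _).1]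
    simp only [norm_mul (((cConst μ)⁻¹ : ℝ) : ℂ), integral_const_mul]
    rw [mul_left_comm]
    gcongr
  have n2 : (eLpNorm (fun x => (rWeight μ x : ℂ) * u x) ⊤ halfLine).toReal ≤ l⁻¹ * M := by
    rw [mul_comm]
    refine ENNReal.toReal_le_of_le_ofReal (by positivity) ?_
    rw [eLpNorm_exponent_top]
    exact eLpNormEssSup_le_of_ae_bound hbound
  refine ⟨⟨u, m1, m2⟩, fun φ hφ => ?_, ?_⟩
  · obtain ⟨C₁, hC₁⟩ := hφ.exists_bound
    obtain ⟨C₂, hC₂⟩ := hφ.exists_bound_besselDiff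
    have hY : u ∈ Y μ := ⟨m1, m2⟩
    have i1 := integrable_pair hμ hY hφ.continuousOn hC₁
    have i2 := integrable_pair hμ hY hφ.continuousOn_besselDiff hC₂
    have i3 := integrable_pair hμ f.2 hφ.continuousOn hC₁
    have key := integral_resolventFun_mul hμ hl hf hi hφ
    have e1 : ∫ x, resolventFun μ l f.1 x * (l * φ x - besselDiff μ φ x) ∂halfLine =
        l * (∫ x, u x * φ x ∂halfLine) - ∫ x, u x * besselDiff μ φ x ∂halfLine := by
      rw [← integral_const_mul, ← integral_sub (i1.const_mul _) i2]
      refine integral_congr_ae ?_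
      filter_upwards [hu] with x hx
      rw [hx]
      ring
    have e2 : (fun x => (((l : ℂ) • u - f.1 : ℝ →ₘ[halfLine] ℂ) : ℝ → ℂ) x * φ x) =ᵐ[halfLine]
        fun x => l * (u x * φ x) - f.1 x * φ x := by
      filter_upwards [AEEqFun.coeFn_sub ((l : ℂ) • u) f.1, AEEqFun.coeFn_smul (l : ℂ) u]
        with x h1 h2
      rw [h1, Pi.sub_apply, h2, Pi.smul_apply, smul_eq_mul]
      ring
    refine ⟨(integrable_congr e2).2 ((i1.const_mul _).sub i3), i2, ?_⟩
    rw [integral_congr_ae e2, integral_sub (i1.const_mul _) i3, integral_const_mul, ← key, e1]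
    ring
  -- The factor `l` is moved to the right as `l⁻¹`, so the two components of the norm can be
  -- compared separately.
  · rw [map_smul_eq_mul, Complex.norm_real, Real.norm_of_nonneg hl.le, normY_apply, normY_apply,
      ← le_inv_mul_iff₀ hl, mul_max_of_nonneg _ _ (inv_pos.2 hl).le]
    exact max_le_max n1 n2

/-! ### Iterates of `x⁻¹ D` on the two solutions -/

/-- Each `x⁻¹ D` raises `ν` by one and produces a constant, which `E` collects. All iterates
therefore extend continuously to `0`, which controls `H_μ` bounds there. -/
theorem xInvD_iterate_besselSeries {ν : ℝ} (hν : -1 < ν) (l : ℝ) (E : ℂ) (k : ℕ) :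
    ∃ g : ℝ → ℂ, Continuous g ∧
      EqOn (xInvD^[k] fun x => E * (besselSeries ν (l * x ^ 2 / 4) : ℂ)) g (Ioi 0) := by
  induction k generalizing ν E with
  | zero =>
    refine ⟨_, ?_, fun x _ => rfl⟩
    have : Continuous fun x : ℝ => besselSeries ν (l * x ^ 2 / 4) :=
      continuous_iff_continuousAt.2 fun x => (hasDerivAt_besselSeries_sq hν l x).continuousAt
    exact continuous_const.mul (Complex.continuous_ofReal.comp this)
  | succ k ih =>
    obtain ⟨g, hg, h⟩ := ih (ν := ν + 1) (by linarith) (E * ((l / (2 * (ν + 1)) : ℝ) : ℂ))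
    refine ⟨g, hg, fun x hx => ?_⟩
    rw [Function.iterate_succ_apply, ← h hx]
    refine xInvD_iterate_congr isOpen_Ioi (fun y hy => xInvD_eq_of_hasDerivAt hy ?_) k hx
    refine ((hasDerivAt_besselSeries_sq hν l y).ofReal_comp.const_mul E).congr_deriv ?_
    push_cast
    ring

/-- Applying `x⁻¹ D` to the equation gives one of the same form with the middle coefficient
increased by `2`, as `x⁻¹ D (x²) = 2`. -/
theorem xInvD_iterate_equation {f : ℝ → ℂ} (hf : ContDiffOn ℝ ∞ f (Ioi 0))
    (h : ∀ x : ℝ, 0 < x →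
      (x : ℂ) ^ 2 * (xInvD^[2] f) x + (2 * μ + 2) * (xInvD^[1] f) x = l * f x) (k : ℕ) :
    ∀ x : ℝ, 0 < x → (x : ℂ) ^ 2 * (xInvD^[k + 2] f) x +
      (2 * μ + 2 + 2 * k) * (xInvD^[k + 1] f) x = l * (xInvD^[k] f) x := by
  induction k with
  | zero => intro x hx; simpa using h x hx
  | succ k ih =>
    intro x hx
    have hx' : (x : ℂ) ≠ 0 := by exact_mod_cast hx.ne'
    have hd : ∀ j, HasDerivAt (xInvD^[j] f) (x * (xInvD^[j + 1] f) x) x := fun j => by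
      rw [Function.iterate_succ_apply']
      exact hasDerivAt_xInvD (contDiffOn_xInvD_iterate hf j) hx
    have hid : HasDerivAt (fun y : ℝ => (y : ℂ)) 1 x := (hasDerivAt_id x).ofReal_comp
    have h1 := ((hid.pow 2).mul (hd (k + 2))).add ((hd (k + 1)).const_mul (2 * μ + 2 + 2 * k : ℂ))
    have h2 := (hd k).const_mul (l : ℂ)
    have e := (h1.congr_of_eventuallyEq
      (eventuallyEq_of_mem (Ioi_mem_nhds hx) fun y hy => (ih y hy).symm)).unique h2
    refine mul_left_cancel₀ hx' ?_
    push_cast at e ⊢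
    simp only [Nat.add_assoc, Nat.reduceAdd, Pi.pow_apply] at e ⊢
    linear_combination e

/-- The iterated equation expresses `x²` times iterate `k + 2` through the two preceding ones, and
`x² ≥ 1` here. -/
theorem xInvD_iterate_decay {f : ℝ → ℂ} (hf : ContDiffOn ℝ ∞ f (Ioi 0))
    (h : ∀ x : ℝ, 0 < x →
      (x : ℂ) ^ 2 * (xInvD^[2] f) x + (2 * μ + 2) * (xInvD^[1] f) x = l * f x)
    (h₀ : ∀ m : ℕ, ∃ C, ∀ x : ℝ, 1 ≤ x → ‖(x : ℂ) ^ m * f x‖ ≤ C)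
    (h₁ : ∀ m : ℕ, ∃ C, ∀ x : ℝ, 1 ≤ x → ‖(x : ℂ) ^ m * (xInvD^[1] f) x‖ ≤ C) (k : ℕ) :
    ∀ m : ℕ, ∃ C, ∀ x : ℝ, 1 ≤ x → ‖(x : ℂ) ^ m * (xInvD^[k] f) x‖ ≤ C := by
  induction k using Nat.strongRec with
  | ind k ih =>
    match k with
    | 0 => exact h₀
    | 1 => exact h₁
    | k + 2 =>
      intro m
      obtain ⟨C₀, hC₀⟩ := ih k (by omega) m
      obtain ⟨C₁, hC₁⟩ := ih (k + 1) (by omega) m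
      refine ⟨‖(l : ℂ)‖ * C₀ + ‖(2 * μ + 2 + 2 * k : ℂ)‖ * C₁, fun x hx => ?_⟩
      have hx0 : 0 < x := by linarith
      have e := xInvD_iterate_equation hf h k x hx0
      have e2 : (x : ℂ) ^ 2 * ((x : ℂ) ^ m * (xInvD^[k + 2] f) x) =
          l * ((x : ℂ) ^ m * (xInvD^[k] f) x) -
            (2 * μ + 2 + 2 * k) * ((x : ℂ) ^ m * (xInvD^[k + 1] f) x) := by
        linear_combination (x : ℂ) ^ m * e
      calc ‖(x : ℂ) ^ m * (xInvD^[k + 2] f) x‖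
          ≤ x ^ 2 * ‖(x : ℂ) ^ m * (xInvD^[k + 2] f) x‖ :=
            le_mul_of_one_le_left (norm_nonneg _) (one_le_pow₀ hx)
        _ = ‖(x : ℂ) ^ 2 * ((x : ℂ) ^ m * (xInvD^[k + 2] f) x)‖ := by
            rw [norm_mul ((x : ℂ) ^ 2), norm_pow, Complex.norm_real, Real.norm_of_nonneg hx0.le]
        _ ≤ _ := by
            rw [e2]
            refine (norm_sub_le _ _).trans ?_
            rw [norm_mul (l : ℂ), norm_mul (2 * μ + 2 + 2 * k : ℂ)]
            gcongr
            · exact hC₀ x hx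
            · exact hC₁ x hx

theorem contDiffOn_ofReal_solQ (hμ : -1 / 2 < μ) (hl : 0 < l) :
    ContDiffOn ℝ ∞ (fun x => (solQ μ l x : ℂ)) (Ioi 0) :=
  Complex.ofRealCLM.contDiff.comp_contDiffOn (contDiffOn_solQ hμ hl)

theorem contDiff_ofReal_solP (hμ : -1 / 2 < μ) (l : ℝ) :
    ContDiff ℝ ∞ (fun x => (solP μ l x : ℂ)) :=
  Complex.ofRealCLM.contDiff.comp (contDiff_solP hμ l)

theorem xInvD_iterate_solQ_decay (hμ : -1 / 2 < μ) (hl : 0 < l) (E : ℂ) (k m : ℕ) :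
    ∃ C, ∀ x : ℝ, 1 ≤ x → ‖(x : ℂ) ^ m * (xInvD^[k] fun x => E * (solQ μ l x : ℂ)) x‖ ≤ C := by
  have hj := isRadialJet_solQ hμ hl
  have h1 : EqOn (xInvD^[1] fun x => E * (solQ μ l x : ℂ)) (fun x => E * (solQD μ l x : ℂ))
      (Ioi 0) := fun x hx =>
    xInvD_eq_of_hasDerivAt hx (((hj x hx).1.const_mul E).congr_deriv (by ring))
  have h2 : EqOn (xInvD^[2] fun x => E * (solQ μ l x : ℂ)) (fun x => E * (solQDD μ l x : ℂ))
      (Ioi 0) := fun x hx => by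
    refine (xInvD_congr isOpen_Ioi h1 hx).trans ?_
    exact xInvD_eq_of_hasDerivAt hx (((hj x hx).2.const_mul E).congr_deriv (by ring))
  refine xInvD_iterate_decay (μ := μ) (l := l)
    (contDiffOn_const.mul (contDiffOn_ofReal_solQ hμ hl)) (fun x hx => ?_)
    (fun m => ?_) (fun m => ?_) k m
  · rw [h1 hx, h2 hx]
    have : (x : ℂ) ^ 2 * solQDD μ l x + (2 * μ + 2) * solQD μ l x = l * solQ μ l x := by
      exact_mod_cast solQ_equation μ l hx
    linear_combination E * this
  · obtain ⟨C, hC⟩ := exists_solQ_decay hμ hl m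
    refine ⟨‖E‖ * C, fun x hx => ?_⟩
    have hx0 : 0 < x := by linarith
    rw [mul_left_comm, norm_mul, norm_mul, norm_pow, Complex.norm_real, Complex.norm_real,
      Real.norm_of_nonneg hx0.le, Real.norm_of_nonneg (solQ_nonneg hμ hl hx0)]
    gcongr
    exact hC x hx
  · obtain ⟨C, hC⟩ := exists_solQD_decay hμ hl m
    refine ⟨‖E‖ * C, fun x hx => ?_⟩
    have hx0 : 0 < x := by linarith
    rw [h1 hx0, mul_left_comm, norm_mul, norm_mul, norm_pow, Complex.norm_real, Complex.norm_real,
      Real.norm_of_nonneg hx0.le, Real.norm_eq_abs]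
    gcongr
    exact hC x hx

/-! ### Green potentials of test functions -/

theorem IsTest.exists_support_subset {χ : ℝ → ℂ} (hχ : IsTest χ) :
    ∃ a b : ℝ, 0 < a ∧ 1 ≤ b ∧ ∀ x, (x < a ∨ b < x) → χ x = 0 := by
  have hK : IsCompact (tsupport χ) := hχ.2.1
  obtain ⟨a, ha, hKa⟩ := hK.exists_forall_le' (f := id) continuousOn_id fun x hx => hχ.2.2 hx
  obtain ⟨b, hb⟩ := hK.bddAbove
  -- The right end is taken at least `1` so that the decay bounds for `solQ` apply beyond it.
  refine ⟨a, max b 1, ha, le_max_right _ _,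
    fun x hx => image_eq_zero_of_notMem_tsupport fun hmem => ?_⟩
  rcases hx with hx | hx
  · exact absurd (hKa x hmem) (not_le.2 hx)
  · exact absurd (hb hmem) (not_le.2 (lt_of_le_of_lt (le_max_left _ _) hx))

theorem IsTest.contDiff_integral {h : ℝ → ℂ} (hh : IsTest h) :
    ContDiff ℝ ∞ fun x => ∫ t in (0 : ℝ)..x, h t := by
  have hd : ∀ x, HasDerivAt (fun x => ∫ t in (0 : ℝ)..x, h t) (h x) x := fun x =>
    hh.1.continuous.integral_hasStrictDerivAt 0 x |>.hasDerivAt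
  refine contDiff_infty_iff_deriv.2 ⟨fun x => (hd x).differentiableAt, ?_⟩
  rw [funext fun x => (hd x).deriv]
  exact hh.1

/-- The `H_μ` bounds come from three regions: continuity of the iterates of `p` up to `0`,
compactness of `[a, b]`, and rapid decay of the iterates of `q`. -/
theorem memH_of_eqOn (hμ : -1 / 2 < μ) (hl : 0 < l) {v : ℝ → ℂ} (hv : ContDiffOn ℝ ∞ v (Ioi 0))
    {a b : ℝ} {E D : ℂ} (ha : 0 < a) (hb : 1 ≤ b)
    (hP : EqOn v (fun x => E * (solP μ l x : ℂ)) (Ioo 0 a))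
    (hQ : EqOn v (fun x => D * (solQ μ l x : ℂ)) (Ioi b)) :
    MemH μ fun x => ((x ^ (μ + 1 / 2) : ℝ) : ℂ) * v x := by
  refine ⟨(contDiffOn_ofReal_rpow _).mul hv, fun m k => ?_⟩
  have hr : EqOn (fun y : ℝ => (rWeight μ y : ℂ) * (((y ^ (μ + 1 / 2) : ℝ) : ℂ) * v y)) v
      (Ioi 0) := fun y hy => by
    simp only
    rw [← mul_assoc, ← Complex.ofReal_mul, rWeight_mul_rpow μ hy, Complex.ofReal_one, one_mul]
  obtain ⟨g, hg, hgP⟩ := xInvD_iterate_besselSeries (ν := μ) (by linarith) l E k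
  obtain ⟨C₁, hC₁⟩ := (isCompact_Icc (a := (0 : ℝ)) (b := a)).exists_bound_of_continuousOn
    (f := fun x : ℝ => (x : ℂ) ^ m * g x) ((Complex.continuous_ofReal.pow m).mul hg).continuousOn
  obtain ⟨C₂, hC₂⟩ := (isCompact_Icc (a := a) (b := b)).exists_bound_of_continuousOn
    (f := fun x : ℝ => (x : ℂ) ^ m * (xInvD^[k] v) x)
    ((Complex.continuous_ofReal.pow m).continuousOn.mul
      ((contDiffOn_xInvD_iterate hv k).continuousOn.mono fun x hx => ha.trans_le hx.1))
  obtain ⟨C₃, hC₃⟩ := xInvD_iterate_solQ_decay hμ hl D k m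
  refine ⟨max C₁ (max C₂ C₃), fun x hx => ?_⟩
  rw [xInvD_iterate_congr isOpen_Ioi hr k hx]
  rcases lt_or_ge x a with hxa | hxa
  · refine le_trans ?_ (le_max_left _ _)
    rw [xInvD_iterate_congr isOpen_Ioo hP k ⟨hx, hxa⟩]
    have := hC₁ x ⟨hx.le, hxa.le⟩
    rw [← hgP hx] at this
    exact this
  · refine le_trans ?_ (le_max_right _ _)
    rcases le_or_gt x b with hxb | hxb
    · exact (hC₂ x ⟨hxa, hxb⟩).trans (le_max_left _ _)
    · refine le_trans ?_ (le_max_right _ _)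
      rw [xInvD_iterate_congr isOpen_Ioi hQ k hxb]
      exact hC₃ x (hb.trans hxb.le)

/-- The equation `l φ - S_μ φ = χ` is solvable in `H_μ` for test functions `χ`. -/
theorem IsTest.exists_memH (hμ : -1 / 2 < μ) (hl : 0 < l) {χ : ℝ → ℂ} (hχ : IsTest χ) :
    ∃ φ, MemH μ φ ∧ ∀ x : ℝ, 0 < x → l * φ x - besselDiff μ φ x = χ x := by
  have hκ : IsTest fun x => (rWeight μ x : ℂ) * χ x := hχ.mul (contDiffOn_rWeight μ)
  set κ : ℝ → ℂ := fun x => (rWeight μ x : ℂ) * χ x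
  have hwκ : IsTest fun x => ((x ^ (2 * μ + 1) : ℝ) : ℂ) * κ x := hκ.mul (contDiffOn_ofReal_rpow _)
  have hhP : IsTest fun x => (solP μ l x : ℂ) * (((x ^ (2 * μ + 1) : ℝ) : ℂ) * κ x) :=
    hwκ.mul (contDiff_ofReal_solP hμ l).contDiffOn
  have hhQ : IsTest fun x => (solQ μ l x : ℂ) * (((x ^ (2 * μ + 1) : ℝ) : ℂ) * κ x) :=
    hwκ.mul (contDiffOn_ofReal_solQ hμ hl)
  set hp : ℝ → ℂ := fun x => (solP μ l x : ℂ) * (((x ^ (2 * μ + 1) : ℝ) : ℂ) * κ x)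
  set hq : ℝ → ℂ := fun x => (solQ μ l x : ℂ) * (((x ^ (2 * μ + 1) : ℝ) : ℂ) * κ x)
  obtain ⟨a, b, ha, hb, hsupp⟩ := hχ.exists_support_subset
  have hp0 : ∀ x, (x < a ∨ b < x) → hp x = 0 := fun x hx => by simp [hp, κ, hsupp x hx]
  have hq0 : ∀ x, (x < a ∨ b < x) → hq x = 0 := fun x hx => by simp [hq, κ, hsupp x hx]
  set A : ℝ → ℂ := fun x => ∫ t in (0 : ℝ)..x, hp t
  set B : ℝ → ℂ := fun x => ∫ t in (0 : ℝ)..x, hq t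
  have hA : ∀ x, HasDerivAt A (hp x) x := fun x =>
    (hhP.1.continuous.integral_hasStrictDerivAt 0 x).hasDerivAt
  have hB : ∀ x, HasDerivAt B (hq x) x := fun x =>
    (hhQ.1.continuous.integral_hasStrictDerivAt 0 x).hasDerivAt
  have hleft : ∀ {h : ℝ → ℂ}, (∀ x, (x < a ∨ b < x) → h x = 0) → ∀ x ∈ Ioo 0 a,
      ∫ t in (0 : ℝ)..x, h t = 0 := fun {h} h0 x hx => by
    refine (intervalIntegral.integral_congr (g := fun _ => 0) fun t ht => ?_).trans (by simp)
    rw [uIcc_of_le hx.1.le] at ht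
    exact h0 t (Or.inl (ht.2.trans_lt hx.2))
  have hright : ∀ {h : ℝ → ℂ}, Continuous h → (∀ x, (x < a ∨ b < x) → h x = 0) → ∀ x ∈ Ioi b,
      ∫ t in (0 : ℝ)..x, h t = ∫ t in (0 : ℝ)..b, h t := fun {h} hc h0 x hx => by
    have hx : b < x := hx
    rw [← intervalIntegral.integral_add_adjacent_intervals (hc.intervalIntegrable 0 b)
      (hc.intervalIntegrable b x), intervalIntegral.integral_of_le hx.le,
      setIntegral_eq_zero_of_forall_eq_zero fun t ht => h0 t (Or.inr ht.1), add_zero]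
  -- Variation of constants. `B b - B x` is the integral of `hq` from `x` to `b`, so `v` is a
  -- multiple of `p` left of the support and of `q` right of it.
  set v : ℝ → ℂ := fun x => solQ μ l x * A x + solP μ l x * (B b - B x)
  set v₁ : ℝ → ℂ := fun x => solQD μ l x * A x + solPD μ l x * (B b - B x)
  -- The derivatives of `A` and `B` cancel in `v'`; in the derivative of `v₁` they meet the
  -- Wronskian and produce the term with `κ`.
  set v₂ : ℝ → ℂ := fun x =>
    solQDD μ l x * A x + solPDD μ l x * (B b - B x) - ((x : ℂ) ^ 2)⁻¹ * κ x
  have hv : ContDiffOn ℝ ∞ v (Ioi 0) :=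
    ((contDiffOn_ofReal_solQ hμ hl).mul hhP.contDiff_integral.contDiffOn).add
      ((contDiff_ofReal_solP hμ l).contDiffOn.mul
        (contDiffOn_const.sub hhQ.contDiff_integral.contDiffOn))
  have hj : IsRadialJet v v₁ v₂ := fun x hx => by
    have hx' : (x : ℂ) ≠ 0 := by exact_mod_cast hx.ne'
    have jP := isRadialJet_solP hμ l x hx
    have jQ := isRadialJet_solQ hμ hl x hx
    have hW : ((x : ℂ) * ((x ^ (2 * μ + 1) : ℝ) : ℂ)) *
        (solPD μ l x * solQ μ l x - solP μ l x * solQD μ l x) = 1 := by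
      exact_mod_cast wronskian_sol hμ hl hx
    refine ⟨((jQ.1.mul (hA x)).add (jP.1.mul ((hB x).const_sub (B b)))).congr_deriv ?_,
      ((jQ.2.mul (hA x)).add (jP.2.mul ((hB x).const_sub (B b)))).congr_deriv ?_⟩
    · simp only [v₁, hp, hq]
      ring
    · simp only [v₂, hp, hq]
      field_simp
      linear_combination (-κ x) * hW
  refine ⟨fun x => ((x ^ (μ + 1 / 2) : ℝ) : ℂ) * v x,
    memH_of_eqOn hμ hl hv (E := B b) (D := A b) ha hb (fun x hx => ?_) fun x hx => ?_,
    fun x hx => ?_⟩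
  · have h1 : A x = 0 := hleft hp0 x hx
    have h2 : B x = 0 := hleft hq0 x hx
    simp only [v, h1, h2]
    ring
  · have h1 : A x = A b := hright hhP.1.continuous hp0 x hx
    have h2 : B x = B b := hright hhQ.1.continuous hq0 x hx
    simp only [v, h1, h2]
    ring
  · have hx' : (x : ℂ) ≠ 0 := by exact_mod_cast hx.ne'
    have hr : (rWeight μ x : ℂ) * ((x ^ (μ + 1 / 2) : ℝ) : ℂ) = 1 := by
      exact_mod_cast rWeight_mul_rpow μ hx
    have eP : (x : ℂ) ^ 2 * solPDD μ l x + (2 * μ + 2) * solPD μ l x = l * solP μ l x := by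
      exact_mod_cast solP_equation hμ l x
    have eQ : (x : ℂ) ^ 2 * solQDD μ l x + (2 * μ + 2) * solQD μ l x = l * solQ μ l x := by
      exact_mod_cast solQ_equation μ l hx
    have ev : (x : ℂ) ^ 2 * v₂ x + (2 * μ + 2) * v₁ x = l * v x - κ x := by
      simp only [v, v₁, v₂]
      rw [mul_sub, mul_inv_cancel_left₀ (pow_ne_zero 2 hx')]
      linear_combination A x * eQ + (B b - B x) * eP
    rw [besselDiff_of_isRadialJet hj (fun _ _ => rfl) hx, ev]
    simp only [κ]
    linear_combination χ x * hr

/-! ### Injectivity of `l - S_μ` -/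

/-- Duality: writing a test function as `χ = l φ - S_μ φ` with `φ ∈ H_μ` turns `∫ f χ` into the
pairing of `l f - S_μ f = 0` with `φ`. -/
theorem eq_zero_of_isBesselImage_smul (hμ : -1 / 2 < μ) (hl : 0 < l) {f : ℝ →ₘ[halfLine] ℂ}
    (hf : f ∈ Y μ) (h : IsBesselImage μ f ((l : ℂ) • f)) : f = 0 := by
  have hz : ∀ χ, IsTest χ → ∫ x, f x * χ x ∂halfLine = 0 := fun χ hχ => by
    obtain ⟨φ, hφ, e⟩ := hχ.exists_memH hμ hl
    obtain ⟨i1, i2, h3⟩ := h φ hφ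
    rw [← sub_eq_zero, ← integral_sub i1 i2] at h3
    rw [← h3]
    refine integral_congr_ae ?_
    filter_upwards [ae_halfLine_pos, AEEqFun.coeFn_smul (l : ℂ) f] with x hx hs
    rw [← e x hx, hs, Pi.smul_apply, smul_eq_mul]
    ring
  have hloc : LocallyIntegrableOn (⇑f) (Ioi 0) halfLine := by
    -- `f` is the integrable function `x^(μ+1/2) f` times the weight `r`, which is continuous on
    -- `(0, ∞)`.
    have h1 := ((integrable_rpow_mul_of_mem_Y hμ hf).locallyIntegrable.locallyIntegrableOn
      (Ioi 0)).continuousOn_mul (contDiffOn_rWeight μ).continuousOn isOpen_Ioi.isLocallyClosed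
    intro x hx
    obtain ⟨s, hs, hi⟩ := h1 x hx
    refine ⟨s, hs, hi.congr (ae_restrict_of_ae ?_)⟩
    filter_upwards [ae_halfLine_pos] with y hy
    rw [← mul_assoc, ← Complex.ofReal_mul, rWeight_mul_rpow μ hy, Complex.ofReal_one, one_mul]
  have hae := isOpen_Ioi.ae_eq_zero_of_integral_contDiff_smul_eq_zero hloc
    (fun b hb hb2 hb3 => by
      have ht : IsTest fun y => (b y : ℂ) := by
        refine ⟨Complex.ofRealCLM.contDiff.comp hb, hb2.comp_left (g := Complex.ofReal) rfl, ?_⟩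
        exact (closure_mono (Function.support_comp_subset (g := Complex.ofReal) rfl b)).trans hb3
      rw [← hz _ ht]
      congr 1; ext x; simp [mul_comm])
  refine AEEqFun.ext ?_
  filter_upwards [hae, ae_halfLine_pos, AEEqFun.coeFn_zero (α := ℝ) (μ := halfLine) (β := ℂ)]
    with x hx hx2 hx3
  rw [hx hx2, hx3]; rfl

theorem hasContractiveResolvent (hμ : -1 / 2 < μ) (hl : 0 < l) : HasContractiveResolvent μ l :=
  ⟨fun _ hf h => eq_zero_of_isBesselImage_smul hμ hl hf h, exists_solution_Y hμ hl⟩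

end Bessel

theorem mainTheorem4 (μ : ℝ) (hμ : -1 / 2 < μ) :
    Bessel.IsFrechetSpace (Bessel.B μ) ∧
      Continuous (-Bessel.besselB μ) ∧
      Bessel.IsNonnegativeOperator ((-Bessel.besselB μ).toPMap ⊤) :=
  ⟨Bessel.isFrechetSpace_B hμ, Bessel.continuous_neg_besselB μ,
    Bessel.isNonnegativeOperator_of_hasContractiveResolvent fun _ ht =>
      Bessel.hasContractiveResolvent hμ ht⟩
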